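/- Let $a,b,c,\nu$ be real, let $J_\nu(z)=\sum_{n\ge 0}\frac{(-1)^n}{n!\,\Gamma(n+\nu+1)}\left(\frac z2\right)^{2n+\nu}$ be the Bessel function of the first kind, and put $$N_\nu(z)=az^2J_\nu''(z)+bzJ_\nu'(z)+cJ_\nu(z),\qquad Q(x)=ax(x-1)+bx+c .$$ Write $(x)_n=x(x+1)\cdots(x+n-1)$. Assume that either $c=0$ and $a\ne b$, or $c>0$ and $a<b$; that $\nu\ge 0$ and $\nu\ge x$ for every real root $x$ of $Q$ (that is, $\nu\ge\max\{0,\nu_0\}$, where $\nu_0$ is the largest real root of $Q$, if there is one); and that $Q(\nu)\neq 0$. Then the positive zeros of $N_\nu$ form an infinite strictly increasing sequence $\lambda_{\nu,1}<\lambda_{\nu,2}<\cdots$, and the following hold, all series being absolutely convergent. (1) For every $n\ge 1$, $$\sum_{1\le k_1<\cdots<k_n}\frac1{\lambda_{\nu,k_1}^2\cdots\lambda_{\nu,k_n}^2}=\frac{\Gamma(\nu+1)\,Q(2n+\nu)}{n!\,4^n\,\Gamma(n+\nu+1)\,Q(\nu)}=\frac{Q(2n+\nu)}{n!\,4^n(\nu+1)_n\,Q(\nu)}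 .$$ (2) For every $n\ge 1$, $$\sum_{k=1}^\infty \frac{4^n(-1)^n}{\lambda_{\nu,k}^{2n}}=\det M_n,$$ where $M_n=(m_{ij})_{1\le i,j\le n}$ has last column $m_{in}=-\dfrac{Q(\nu+2i)}{(i-1)!\,(\nu+1)_i\,Q(\nu)}$ for $1\le i\le n$, and for $1\le j\le n-1$ has $m_{ij}=\dfrac{Q(\nu+2(i-j))}{(i-j)!\,(\nu+1)_{i-j}\,Q(\nu)}$ if $i>j$, $m_{jj}=1$, and $m_{ij}=0$ if $i<j$. (3) With $s_n=\sum_{k\ge1}\lambda_{\nu,k}^{-2n}$, $$s_1=\frac{Q(\nu+2)}{4(\nu+1)_1Q(\nu)},\qquad s_2=\frac{(\nu+2)Q^2(\nu+2)-(\nu+1)Q(\nu)Q(\nu+4)}{4^2Q^2(\nu)\prod_{j=1}^2(\nu+1)_j},$$ $$s_3=\frac{(\nu+2)_2Q(\nu+2)\left[2(\nu+2)Q^2(\nu+2)-3(\nu+1)Q(\nu)Q(\nu+4)\right]+(\nu+1)^2(\nu+2)Q^2(\nu)Q(\nu+6)}{2!\,4^3Q^3(\nu)\prod_{j=1}^3(\nu+1)_j},$$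 $$s_4=\frac{(\nu+2)_2\,A}{3!\,4^4Q^4(\nu)\prod_{j=1}^4(\nu+1)_j},$$ where $$\begin{aligned}A={}&6(\nu+2)(\nu+2)_3Q^4(\nu+2)-12(\nu+1)_4Q(\nu)Q^2(\nu+2)Q(\nu+4)\\&+4(\nu+1)(\nu+1)_2(\nu+4)Q^2(\nu)Q(\nu+2)Q(\nu+6)\\&+(\nu+1)^2Q^2(\nu)\left(3(\nu+3)_2Q^2(\nu+4)-(\nu+1)_2Q(\nu)Q(\nu+8)\right).\end{aligned}$$ -/

import Mathlib

noncomputable section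

/-- The Bessel function of the first kind of real order `ν`, by its series
(principal branch of the powers). -/
def besselJ (ν : ℝ) (z : ℂ) : ℂ :=
  ∑' n : ℕ, (-1 : ℂ) ^ n / ((n.factorial : ℂ) * Complex.Gamma ((n : ℂ) + (ν : ℂ) + 1)) *
    (z / 2) ^ (2 * (n : ℂ) + (ν : ℂ))

/-- `N_ν(z) = a z² J_ν''(z) + b z J_ν'(z) + c J_ν(z)`. -/
def besselN (a b c ν : ℝ) (z : ℂ) : ℂ :=
  (a : ℂ) * z ^ 2 * deriv (deriv (besselJ ν)) z + (b : ℂ) * z * deriv (besselJ ν) z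
    + (c : ℂ) * besselJ ν z

/-- The quadratic `Q(x) = a x (x - 1) + b x + c`. -/
def quadQ (a b c x : ℝ) : ℝ := a * x * (x - 1) + b * x + c

/-- The positive zeros of `N_ν` in increasing order, numbered from `0`: each one is the least
zero beyond the preceding one. -/
def besselNZero (a b c ν : ℝ) : ℕ → ℝ
  | 0 => sInf {x : ℝ | 0 < x ∧ besselN a b c ν (x : ℂ) = 0}
  | k + 1 => sInf {x : ℝ | besselNZero a b c ν k < x ∧ besselN a b c ν (x : ℂ) = 0}

/-- The Pochhammer symbol `(x)_n = x (x + 1) ⋯ (x + n - 1)`. -/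
def poch (x : ℝ) (n : ℕ) : ℝ := (ascPochhammer ℝ n).eval x

/-- The `n × n` matrix of the determinant formula. Rows and columns are numbered from `0`. Its last
column has the entries `-Q(ν + 2(i+1)) / (i! (ν+1)_{i+1} Q(ν))`; the other columns are those of
a unit lower triangular Toeplitz matrix. -/
def zeroSumMatrix (a b c ν : ℝ) (n : ℕ) : Matrix (Fin n) (Fin n) ℝ :=
  Matrix.of fun i j =>
    if (j : ℕ) + 1 = n then
      -quadQ a b c (ν + 2 * ((i : ℕ) + 1 : ℝ)) /
        (((i : ℕ).factorial : ℝ) * poch (ν + 1) ((i : ℕ) + 1) * quadQ a b c ν)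
    else if j < i then
      quadQ a b c (ν + 2 * (((i : ℕ) - (j : ℕ) : ℕ) : ℝ)) /
        ((((i : ℕ) - (j : ℕ)).factorial : ℝ) * poch (ν + 1) ((i : ℕ) - (j : ℕ)) * quadQ a b c ν)
    else if j = i then 1
    else 0

end

/-! Put w = z² and D = d/dz. Since a z²D² + b zD + c = Q(zD) and zD multiplies z^(2n+ν) by 2n+ν, N_ν
is Q(ν)(z/2)^ν/Γ(ν+1) times f(w) = ∑ Q(ν+2n)/Q(ν) · (-1)^n/(n! 4^n (ν+1)_n) · w^n. The coefficients
decay like 1/n!², so f has order at most 1/2. If all its zeros x are positive and simple, Hadamard's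
theorem gives f(w) = ∏ (1 - w/x) without an exponential factor (`PosSimpleZeros.hasProd`), and the x
are the squares of the λ's. Expanding the product and comparing coefficients gives the elementary
symmetric sums (`hasSum_esymm`). Newton's identities (`newton_hasSum`) form a unit triangular
Toeplitz system for the power sums, which Cramer's rule turns into a determinant
(`det_updateCol_toeplitz`); run as a recursion, they give the first four sums.

The main point is that the zeros of f are positive and simple (`posSimpleZeros_quadCoeff`). For the
Bessel series g itself, each alternative is excluded by a monotone quantity built from the
differential equation. With θ = w d/dw, the operators α + θ - βw, α > 0, β ≥ 0, preserve the class
(`PosSimpleZeros.zeros_laguerre`), because α + w f'/f - βw is a sum over the zeros whose imaginary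
part, sign and derivative are visible. Now f is a quadratic in θ applied to g. If a/(b-a) ≥ 0, the
Bessel equation trades θ² for θ and multiplication by w, leaving one such operator. If a/(b-a) < 0,
Q has real roots below ν, and f comes from g by two such operators with β = 0.

No coefficient of f vanishes, because Q keeps its sign beyond ν; hence f is not a finite product and
has infinitely many zeros. -/

section

open Filter Topology Metric

/-! ### Hadamard factorisation in order at most one half -/

/-- Entire functions of order at most one half, normalised by `f 0 = 1`, all of whose zeros are
positive reals and simple. -/
structure PosSimpleZeros (f : ℂ → ℂ) : Prop where
  differentiable : Differentiable ℂ f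
  map_zero : f 0 = 1
  growth : ∃ C : ℝ, 0 < C ∧ ∀ w, ‖f w‖ ≤ C * Real.exp (C * √‖w‖)
  zeros : ∀ w, f w = 0 → ∃ x : ℝ, 0 < x ∧ w = x ∧ deriv f w ≠ 0

/-- An entire function is divisible by the product of `1 - w / s` over finitely many zeros. -/
lemma exists_eq_prod_one_sub_div_mul {f : ℂ → ℂ} (hf : Differentiable ℂ f) (S : Finset ℂ)
    (h0 : (0 : ℂ) ∉ S) (hS : ∀ s ∈ S, f s = 0) :
    ∃ q : ℂ → ℂ, Differentiable ℂ q ∧ ∀ w, f w = (∏ s ∈ S, (1 - w / s)) * q w := by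
  induction S using Finset.induction_on with
  | empty => exact ⟨f, hf, by simp⟩
  | insert s S hs ih =>
    obtain ⟨q, hq, hfq⟩ := ih (fun h => h0 (Finset.mem_insert_of_mem h))
      (fun t ht => hS t (Finset.mem_insert_of_mem ht))
    have hs0 : s ≠ 0 := fun h => h0 (h ▸ Finset.mem_insert_self _ _)
    have hqs : q s = 0 := by
      have h := hS s (Finset.mem_insert_self _ _)
      rw [hfq, mul_eq_zero, Finset.prod_eq_zero_iff] at h
      rcases h with ⟨t, ht, h⟩ | h
      · have ht0 : t ≠ 0 := fun h => h0 (h ▸ Finset.mem_insert_of_mem ht)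
        have : s = t := by
          field_simp at h
          linear_combination -h
        exact absurd (this ▸ ht) hs
      · exact h
    -- Since q s = 0, q w = (w - s) · dslope q s w, and w - s = (1 - w/s)(-s).
    refine ⟨fun w => -s * dslope q s w, ?_, fun w => ?_⟩
    · have : Differentiable ℂ (dslope q s) := by
        rw [← differentiableOn_univ] at hq ⊢
        exact (Complex.differentiableOn_dslope univ_mem).2 hq
      exact this.const_mul _
    · rw [Finset.prod_insert hs, hfq]
      have h := sub_smul_dslope q s w
      rw [hqs, sub_zero, smul_eq_mul] at h
      rw [← h]
      field_simp
      ring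

/-- If the zeros in `S` are simple, the quotient does not vanish there. -/
lemma quotient_ne_zero_of_simple {f q : ℂ → ℂ} (hq : Differentiable ℂ q) {S : Finset ℂ}
    (hfq : ∀ w, f w = (∏ s ∈ S, (1 - w / s)) * q w) {w : ℂ} (hw0 : w ≠ 0) (hw : w ∈ S)
    (hd : deriv f w ≠ 0) : q w ≠ 0 := by
  intro hqw
  apply hd
  have hf : f = fun w => (∏ s ∈ S, (1 - w / s)) * q w := funext hfq
  have hP : Differentiable ℂ fun w : ℂ => ∏ s ∈ S, (1 - w / s) := by fun_prop
  rw [hf, deriv_fun_mul (hP w) (hq w), hqw, Finset.prod_eq_zero hw (by field_simp; simp)]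
  simp

lemma finite_zeros_of_isCompact {f : ℂ → ℂ} (hf : Differentiable ℂ f) {z : ℂ} (hz : f z ≠ 0)
    {K : Set ℂ} (hK : IsCompact K) : {w | w ∈ K ∧ f w = 0}.Finite := by
  by_contra hinf
  obtain ⟨x, -, hx⟩ := Set.Infinite.exists_accPt_of_subset_isCompact
    (s := {w | w ∈ K ∧ f w = 0}) hinf hK (fun w hw => hw.1)
  have h := AnalyticOnNhd.eqOn_zero_of_preconnected_of_frequently_eq_zero (U := Set.univ)
    (f := f) (fun w _ => hf.analyticAt w) isPreconnected_univ (Set.mem_univ x)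
    ((accPt_iff_frequently_nhdsNE.1 hx).mono fun y hy => hy.2)
  exact hz (h (Set.mem_univ z))

namespace PosSimpleZeros

variable {f : ℂ → ℂ}

lemma finite_le (hf : PosSimpleZeros f) (R : ℝ) : {x : ℝ | f x = 0 ∧ x ≤ R}.Finite := by
  have h := finite_zeros_of_isCompact hf.differentiable (z := 0) (by simp [hf.map_zero])
    (isCompact_closedBall (0 : ℂ) R)
  refine (h.preimage (f := ((↑) : ℝ → ℂ)) Complex.ofReal_injective.injOn).subset ?_
  rintro x ⟨hx, hxR⟩
  obtain ⟨y, hy, hxy, -⟩ := hf.zeros _ hx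
  have : x = y := by exact_mod_cast hxy
  refine ⟨?_, hx⟩
  rw [mem_closedBall_zero_iff, Complex.norm_real, Real.norm_eq_abs, abs_of_pos (this ▸ hy)]
  exact hxR

lemma pos (hf : PosSimpleZeros f) {x : ℝ} (hx : f x = 0) : 0 < x := by
  obtain ⟨y, hy, hxy, -⟩ := hf.zeros _ hx
  have : x = y := by exact_mod_cast hxy
  exact this ▸ hy

/-- The zeros up to `R`. -/
noncomputable def zerosLE (hf : PosSimpleZeros f) (R : ℝ) : Finset {x : ℝ // f x = 0} :=
  ((hf.finite_le R).preimage (f := ((↑) : {x : ℝ // f x = 0} → ℝ))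
    Subtype.val_injective.injOn).toFinset

lemma mem_zerosLE (hf : PosSimpleZeros f) {R : ℝ} {x : {x : ℝ // f x = 0}} :
    x ∈ hf.zerosLE R ↔ (x : ℝ) ≤ R := by
  simp [zerosLE, x.2]

lemma tendsto_zerosLE (hf : PosSimpleZeros f) : Tendsto hf.zerosLE atTop atTop := by
  refine tendsto_atTop_finset_of_monotone (fun R R' h x hx => ?_) fun x => ⟨x, ?_⟩
  · rw [mem_zerosLE] at *
    exact hx.trans h
  · rw [mem_zerosLE]

/-- Once the zeros up to R are divided out, simplicity leaves none in the disc of radius R. The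
bound is taken on the circle of radius 2R, where |w/x| ≥ 2 makes each divided factor at least 1 in
modulus, and is carried inside by the maximum principle. -/
lemma exists_quotient (hf : PosSimpleZeros f) {C : ℝ}
    (hgr : ∀ w, ‖f w‖ ≤ C * Real.exp (C * √‖w‖)) {R : ℝ} (hR : 0 < R) :
    ∃ q : ℂ → ℂ, Differentiable ℂ q ∧ q 0 = 1 ∧ (∀ w ∈ ball (0 : ℂ) R, q w ≠ 0) ∧
      (∀ w ∈ ball (0 : ℂ) R, ‖q w‖ ≤ C * Real.exp (C * √(2 * R))) ∧
      ∀ w, f w = (∏ x ∈ hf.zerosLE R, (1 - w / ((x : ℝ) : ℂ))) * q w := by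
  classical
  set S : Finset ℂ := (hf.zerosLE R).image fun x : {x : ℝ // f x = 0} => ((x : ℝ) : ℂ) with hSdef
  have hinj : Set.InjOn (fun x : {x : ℝ // f x = 0} => ((x : ℝ) : ℂ)) (hf.zerosLE R) :=
    (Complex.ofReal_injective.comp Subtype.val_injective).injOn
  have hpos : ∀ x : {x : ℝ // f x = 0}, 0 < (x : ℝ) := fun x => hf.pos x.2
  have h0 : (0 : ℂ) ∉ S := by
    simp only [hSdef, Finset.mem_image, not_exists, not_and]
    intro x _ h
    exact (hpos x).ne' (by exact_mod_cast h)
  obtain ⟨q, hq, hfq⟩ := exists_eq_prod_one_sub_div_mul hf.differentiable S h0 (by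
    simp only [hSdef, Finset.mem_image]
    rintro s ⟨x, _, rfl⟩
    exact x.2)
  have hprod : ∀ w : ℂ, ∏ s ∈ S, (1 - w / s) = ∏ x ∈ hf.zerosLE R, (1 - w / ((x : ℝ) : ℂ)) :=
    fun w => by rw [hSdef, Finset.prod_image hinj]
  refine ⟨q, hq, ?_, ?_, ?_, fun w => by rw [hfq, hprod]⟩
  · have := hfq 0
    simpa [hf.map_zero] using this.symm
  · intro w hw hqw
    have hfw : f w = 0 := by rw [hfq, hqw, mul_zero]
    obtain ⟨x, hx, rfl, hd⟩ := hf.zeros w hfw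
    refine quotient_ne_zero_of_simple hq hfq (by exact_mod_cast hx.ne') ?_ hd hqw
    refine Finset.mem_image.2 ⟨⟨x, hfw⟩, ?_, rfl⟩
    rw [mem_zerosLE]
    rw [mem_ball_zero_iff, Complex.norm_real, Real.norm_eq_abs] at hw
    exact (le_abs_self x).trans hw.le
  · intro w hw
    refine Complex.norm_le_of_forall_mem_frontier_norm_le (U := ball (0 : ℂ) (2 * R))
      isBounded_ball hq.diffContOnCl (fun z hz => ?_) (subset_closure ?_)
    · rw [frontier_ball _ (by positivity), mem_sphere_zero_iff_norm] at hz
      have h1 : 1 ≤ ‖∏ s ∈ S, (1 - z / s)‖ := by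
        rw [norm_prod]
        refine Finset.one_le_prod fun s hs => ?_
        obtain ⟨x, hx, rfl⟩ := Finset.mem_image.1 hs
        rw [mem_zerosLE] at hx
        have h2 : 2 ≤ ‖z / ((x : ℝ) : ℂ)‖ := by
          rw [norm_div, hz, Complex.norm_real, Real.norm_eq_abs, abs_of_pos (hpos x),
            le_div_iff₀ (hpos x)]
          linarith
        have := norm_sub_norm_le (z / ((x : ℝ) : ℂ)) 1
        rw [norm_sub_rev, norm_one] at this
        linarith
      calc ‖q z‖ ≤ ‖∏ s ∈ S, (1 - z / s)‖ * ‖q z‖ := le_mul_of_one_le_left (norm_nonneg _) h1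
        _ = ‖f z‖ := by rw [← norm_mul, ← hfq]
        _ ≤ _ := by simpa [hz] using hgr z
    · rw [mem_ball_zero_iff] at *
      linarith

end PosSimpleZeros

/-- A nonvanishing holomorphic function on a disc, equal to one at the centre and bounded, is
close to one near the centre. -/
lemma exists_log_bound {q : ℂ → ℂ} {R M : ℝ} (hR : 0 < R) (hM : 0 < M)
    (hq : DifferentiableOn ℂ q (ball 0 R)) (hq0 : q 0 = 1) (hne : ∀ w ∈ ball (0 : ℂ) R, q w ≠ 0)
    (hb : ∀ w ∈ ball (0 : ℂ) R, ‖q w‖ ≤ Real.exp M) {w : ℂ} (hw : w ∈ ball (0 : ℂ) R) :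
    ∃ h : ℂ, q w = Complex.exp h ∧ ‖h‖ ≤ 2 * M * ‖w‖ / (R - ‖w‖) := by
  -- A primitive of q'/q is a logarithm of q. Its real part is log|q| ≤ M, so Borel–Carathéodory
  -- bounds it.
  have hl : DifferentiableOn ℂ (fun z => deriv q z / q z) (ball 0 R) :=
    (hq.deriv isOpen_ball).div hq hne
  obtain ⟨g, hg⟩ := hl.isExactOn_ball
  have h0 : (0 : ℂ) ∈ ball (0 : ℂ) R := mem_ball_self hR
  have key : ∀ z ∈ ball (0 : ℂ) R, q z = Complex.exp (g z - g 0) := by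
    have hd : ∀ z ∈ ball (0 : ℂ) R,
        HasDerivAt (fun z => q z * Complex.exp (-(g z - g 0))) 0 z := by
      intro z hz
      have h1 := (hq.differentiableAt (isOpen_ball.mem_nhds hz)).hasDerivAt
      have h2 := (((hg z hz).sub_const (g 0)).neg).cexp
      have h3 := h1.mul h2
      convert! h3 using 1
      field_simp [hne z hz]
      simp
    intro z hz
    have hc := (convex_ball (0 : ℂ) R).is_const_of_fderivWithin_eq_zero (𝕜 := ℂ)
      (f := fun z => q z * Complex.exp (-(g z - g 0)))
      (fun z hz => (hd z hz).differentiableAt.differentiableWithinAt) (fun z hz => by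
        rw [fderivWithin_of_isOpen isOpen_ball hz]
        ext
        rw [fderiv_apply_one_eq_deriv, (hd z hz).deriv]
        rfl) hz h0
    simp only [sub_self, neg_zero, Complex.exp_zero, mul_one, hq0, Complex.exp_neg] at hc
    field_simp at hc
    exact hc
  refine ⟨g w - g 0, key w hw, ?_⟩
  refine Complex.borelCaratheodory_zero (f := fun z => g z - g 0) hM
    (fun z hz => ((hg z hz).sub_const _).differentiableAt.differentiableWithinAt) ?_ hR hw (by simp)
  intro z hz
  have := hb z hz
  rw [key z hz, Complex.norm_exp, Real.exp_le_exp] at this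
  exact this

namespace PosSimpleZeros

variable {f : ℂ → ℂ}

/-- The logarithm of the quotient at w is O(√R · ‖w‖ / (R - ‖w‖)), which tends to 0: this is where
order below one removes the exponential factor. -/
lemma tendsto_prod_zerosLE (hf : PosSimpleZeros f) (w : ℂ) :
    Tendsto (fun R => ∏ x ∈ hf.zerosLE R, (1 - w / ((x : ℝ) : ℂ))) atTop (𝓝 (f w)) := by
  obtain ⟨C, hC, hgr⟩ := hf.growth
  have H : ∀ R : ℝ, ‖w‖ < R → ∃ h : ℂ, f w = (∏ x ∈ hf.zerosLE R, (1 - w / ((x : ℝ) : ℂ))) *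
      Complex.exp h ∧ ‖h‖ ≤ 2 * (C + C * √(2 * R)) * ‖w‖ / (R - ‖w‖) := by
    intro R hR
    have hR0 : 0 < R := (norm_nonneg w).trans_lt hR
    obtain ⟨q, hq, hq0, hne, hb, hfq⟩ := hf.exists_quotient hgr hR0
    -- The summand C in M absorbs the prefactor of the growth bound, as C ≤ exp C.
    obtain ⟨h, hh, hle⟩ := exists_log_bound (M := C + C * √(2 * R)) hR0 (by positivity)
      hq.differentiableOn hq0 hne (fun z hz => (hb z hz).trans (by
        rw [Real.exp_add]
        gcongr
        linarith [Real.add_one_le_exp C])) (w := w) (by simpa using hR)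
    exact ⟨h, by rw [hfq, hh], hle⟩
  choose! h hh hle using H
  have hlim : Tendsto (fun R : ℝ => 2 * (C + C * √(2 * R)) * ‖w‖ / (R - ‖w‖)) atTop (𝓝 0) := by
    have h1 : Tendsto (fun R : ℝ => (√R)⁻¹) atTop (𝓝 0) :=
      tendsto_inv_atTop_zero.comp Real.tendsto_sqrt_atTop
    have h2 : Tendsto (fun R : ℝ => 2 * (C * (√R)⁻¹ + C * √2) * ‖w‖ * (√R)⁻¹ /
        (1 - ‖w‖ * ((√R)⁻¹ * (√R)⁻¹))) atTop
        (𝓝 (2 * (C * 0 + C * √2) * ‖w‖ * 0 / (1 - ‖w‖ * (0 * 0)))) := by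
      refine Tendsto.div ?_ ?_ (by simp)
      · exact ((((h1.const_mul C).add_const _).const_mul 2).mul_const _).mul h1
      · exact ((h1.mul h1).const_mul _).const_sub 1
    simp only [mul_zero, zero_div] at h2
    refine h2.congr' ?_
    filter_upwards [eventually_gt_atTop ‖w‖] with R hR
    have hR0 : 0 < R := (norm_nonneg w).trans_lt hR
    rw [Real.sqrt_mul (by norm_num)]
    have hs : √R ≠ 0 := (Real.sqrt_pos.2 hR0).ne'
    have hs2 : R = √R * √R := (Real.mul_self_sqrt hR0.le).symm
    have hd : R - ‖w‖ ≠ 0 := by linarith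
    have hd' : 1 - ‖w‖ * ((√R)⁻¹ * (√R)⁻¹) ≠ 0 := by
      rw [← mul_inv, ← hs2]
      have h4 : 1 - ‖w‖ * R⁻¹ = (R - ‖w‖) / R := by field_simp
      rw [h4]
      exact div_ne_zero hd hR0.ne'
    rw [div_eq_div_iff hd' hd]
    rw [← mul_inv, ← hs2]
    field_simp
    generalize √R = t at *
    subst hs2
    ring
  have hh0 : Tendsto h atTop (𝓝 0) := by
    refine squeeze_zero_norm' ?_ hlim
    filter_upwards [eventually_gt_atTop ‖w‖] with R hR using hle R hR
  have h3 : Tendsto (fun R => f w * Complex.exp (-h R)) atTop (𝓝 (f w)) := by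
    have := ((Complex.continuous_exp.tendsto _).comp hh0.neg).const_mul (f w)
    simpa using this
  refine h3.congr' ?_
  filter_upwards [eventually_gt_atTop ‖w‖] with R hR
  rw [hh R hR, mul_assoc, ← Complex.exp_add]
  simp

/-- At w = -1 all factors are 1 + 1/x, so finite sums of 1/x are dominated by partial products that
converge to ‖f (-1)‖. -/
lemma summable_inv (hf : PosSimpleZeros f) :
    Summable fun x : {x : ℝ // f x = 0} => 1 / (x : ℝ) := by
  have hpos : ∀ x : {x : ℝ // f x = 0}, 0 < (x : ℝ) := fun x => hf.pos x.2
  refine summable_of_sum_le (c := ‖f (-1)‖ + 1) (fun x => (one_div_pos.2 (hpos x)).le) fun T => ?_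
  have h1 := (hf.tendsto_prod_zerosLE (-1)).norm.eventually_le_const (lt_add_one ‖f (-1)‖)
  obtain ⟨R, hR, hTR⟩ := (h1.and (hf.tendsto_zerosLE.eventually_ge_atTop T)).exists
  have hnn : ∀ x : {x : ℝ // f x = 0}, 0 ≤ 1 / (x : ℝ) := fun x => (one_div_pos.2 (hpos x)).le
  calc ∑ x ∈ T, 1 / (x : ℝ) ≤ ∏ x ∈ T, (1 + 1 / (x : ℝ)) := by
        induction T using Finset.cons_induction with
        | empty => simp
        | cons x T hx ih =>
          rw [Finset.sum_cons, Finset.prod_cons]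
          have h2 : 1 ≤ ∏ x ∈ T, (1 + 1 / (x : ℝ)) :=
            Finset.one_le_prod fun x _ => by linarith [hnn x]
          have h3 := ih fun y hy => hTR (Finset.mem_cons_of_mem hy)
          nlinarith [hnn x, mul_nonneg (hnn x) (sub_nonneg.2 h2)]
    _ ≤ ∏ x ∈ hf.zerosLE R, (1 + 1 / (x : ℝ)) :=
        Finset.prod_le_prod_of_subset_of_one_le hTR (fun x _ => by linarith [hnn x])
          (fun x _ _ => by linarith [hnn x])
    _ = ‖∏ x ∈ hf.zerosLE R, (1 - (-1) / ((x : ℝ) : ℂ))‖ := by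
        rw [norm_prod]
        refine Finset.prod_congr rfl fun x _ => ?_
        have : (1 : ℂ) - (-1) / ((x : ℝ) : ℂ) = ((1 + 1 / (x : ℝ) : ℝ) : ℂ) := by
          push_cast; ring
        rw [this, Complex.norm_real, Real.norm_eq_abs, abs_of_nonneg (by linarith [hnn x])]
    _ ≤ _ := hR

/-- Hadamard's factorisation. -/
theorem hasProd (hf : PosSimpleZeros f) (w : ℂ) :
    HasProd (fun x : {x : ℝ // f x = 0} => 1 - w / ((x : ℝ) : ℂ)) (f w) := by
  have hm : Multipliable fun x : {x : ℝ // f x = 0} => 1 + -(w / ((x : ℝ) : ℂ)) := by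
    refine multipliable_one_add_of_summable ((hf.summable_inv.mul_left ‖w‖).congr fun x => ?_)
    rw [norm_neg, norm_div, Complex.norm_real, Real.norm_eq_abs, abs_of_pos (hf.pos x.2),
      mul_one_div]
  have h := hm.hasProd
  simp only [← sub_eq_add_neg] at h
  -- The unordered product exists by absolute convergence; its value is read off along the
  -- particular finite sets `zerosLE R`.
  rwa [tendsto_nhds_unique (h.comp hf.tendsto_zerosLE) (hf.tendsto_prod_zerosLE w)] at h

end PosSimpleZeros

/-! ### Logarithmic derivative and Laguerre-type operators -/

namespace PosSimpleZeros

variable {f : ℂ → ℂ}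

/-- Off the zeros of `f`, the reciprocal distances to the zeros are uniformly summable. -/
lemma exists_norm_sub_inv_le (hf : PosSimpleZeros f) {w : ℂ} (hw : f w ≠ 0) :
    ∃ δ > 0, ∃ K > 0, (∀ z ∈ ball w δ, f z ≠ 0) ∧
      ∀ z ∈ ball w δ, ∀ x : {x : ℝ // f x = 0}, ‖(z - ((x : ℝ) : ℂ))⁻¹‖ ≤ K * (1 / (x : ℝ)) := by
  obtain ⟨ε, hε, hball⟩ := Metric.eventually_nhds_iff_ball.1
    (hf.differentiable.continuous.continuousAt.eventually_ne hw)
  -- K comes from x ≤ |z - x| + |z|, with |z| ≤ ‖w‖ + ε/2 and |z - x| ≥ ε/2.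
  refine ⟨ε / 2, by positivity, 1 + (‖w‖ + ε / 2) / (ε / 2), by positivity,
    fun z hz => hball z (ball_subset_ball (by linarith) hz), fun z hz x => ?_⟩
  have hx := hf.pos x.2
  have h1 : ε / 2 ≤ ‖z - ((x : ℝ) : ℂ)‖ := by
    by_contra! h
    refine hball ((x : ℝ) : ℂ) ?_ x.2
    rw [mem_ball, dist_eq_norm] at *
    calc ‖((x : ℝ) : ℂ) - w‖ = ‖(z - w) - (z - ((x : ℝ) : ℂ))‖ := by ring_nf
      _ ≤ _ := norm_sub_le _ _
      _ < ε := by linarith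
  have h2 : ‖z‖ ≤ ‖w‖ + ε / 2 := by
    rw [mem_ball, dist_eq_norm] at hz
    have := norm_sub_norm_le z w
    linarith
  have h3 : (x : ℝ) ≤ ‖z - ((x : ℝ) : ℂ)‖ + ‖z‖ := by
    have := norm_sub_le z (z - ((x : ℝ) : ℂ))
    rw [sub_sub_cancel, Complex.norm_real, Real.norm_eq_abs, abs_of_pos hx] at this
    linarith
  have h4 : (‖w‖ + ε / 2) ≤ (‖w‖ + ε / 2) / (ε / 2) * ‖z - ((x : ℝ) : ℂ)‖ := by
    rw [div_mul_eq_mul_div, le_div_iff₀ (by positivity)]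
    gcongr
  rw [norm_inv, mul_one_div, le_div_iff₀ hx, inv_mul_le_iff₀ (by linarith)]
  linarith

lemma hasSum_logDeriv (hf : PosSimpleZeros f) {w : ℂ} (hw : f w ≠ 0) :
    HasSum (fun x : {x : ℝ // f x = 0} => (w - ((x : ℝ) : ℂ))⁻¹) (logDeriv f w) := by
  obtain ⟨δ, hδ, K, -, -, hK⟩ := hf.exists_norm_sub_inv_le hw
  have hs : Summable fun x : {x : ℝ // f x = 0} => (w - ((x : ℝ) : ℂ))⁻¹ :=
    (hf.summable_inv.mul_left K).of_norm_bounded fun x => hK w (mem_ball_self hδ) x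
  have hx0 : ∀ x : {x : ℝ // f x = 0}, ((x : ℝ) : ℂ) ≠ 0 := fun x => by
    exact_mod_cast (hf.pos x.2).ne'
  have hwx : ∀ x : {x : ℝ // f x = 0}, w - ((x : ℝ) : ℂ) ≠ 0 := fun x h =>
    hw (by rw [sub_eq_zero.1 h]; exact x.2)
  have hl : ∀ x : {x : ℝ // f x = 0},
      logDeriv (fun z : ℂ => 1 + -(z / ((x : ℝ) : ℂ))) w = (w - ((x : ℝ) : ℂ))⁻¹ := fun x => by
    have h1 : deriv (fun z : ℂ => 1 + -(z / ((x : ℝ) : ℂ))) w = -(1 / ((x : ℝ) : ℂ)) := by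
      simp
    have h2 : 1 + -(w / ((x : ℝ) : ℂ)) = -((w - ((x : ℝ) : ℂ)) / ((x : ℝ) : ℂ)) := by
      field_simp [hx0 x]; ring
    rw [logDeriv_apply, h1, h2]
    field_simp [hx0 x, hwx x]
  have hfp : f = fun z => ∏' x : {x : ℝ // f x = 0}, (1 + -(z / ((x : ℝ) : ℂ))) := by
    funext z
    simp only [← sub_eq_add_neg]
    exact (hf.hasProd z).tprod_eq.symm
  have h := logDeriv_tprod_eq_tsum (s := ball 0 (‖w‖ + 1)) isOpen_ball (x := w) (by simp)
    (f := fun (x : {x : ℝ // f x = 0}) (z : ℂ) => 1 + -(z / ((x : ℝ) : ℂ))) ?_ ?_ ?_ ?_ ?_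
  · rw [← hfp] at h
    simp only [hl] at h
    rw [h]
    exact hs.hasSum
  · intro x h
    apply hwx x
    have := hx0 x
    field_simp at h
    linear_combination -h
  · intro x
    fun_prop
  · simpa only [hl] using hs
  · refine Summable.multipliableLocallyUniformlyOn_one_add isOpen_ball
      (hf.summable_inv.mul_left (‖w‖ + 1)) (Eventually.of_forall fun x z hz => ?_)
      (fun x => by fun_prop)
    rw [norm_neg, norm_div, Complex.norm_real, Real.norm_eq_abs, abs_of_pos (hf.pos x.2),
      mul_one_div]
    rw [mem_ball_zero_iff] at hz
    have := hf.pos x.2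
    gcongr
  · rw [← congrFun hfp w]
    exact hw

lemma hasSum_deriv_logDeriv (hf : PosSimpleZeros f) {w : ℂ} (hw : f w ≠ 0) :
    HasSum (fun x : {x : ℝ // f x = 0} => -((w - ((x : ℝ) : ℂ)) ^ 2)⁻¹)
      (deriv (logDeriv f) w) := by
  obtain ⟨δ, hδ, K, -, hne, hK⟩ := hf.exists_norm_sub_inv_le hw
  have hd : ∀ x : {x : ℝ // f x = 0}, ∀ z ∈ ball w δ,
      HasDerivAt (fun z : ℂ => (z - ((x : ℝ) : ℂ))⁻¹) (-((z - ((x : ℝ) : ℂ)) ^ 2)⁻¹) z := by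
    intro x z hz
    have h0 : z - ((x : ℝ) : ℂ) ≠ 0 := fun h =>
      hne z hz (by rw [sub_eq_zero.1 h]; exact x.2)
    convert! ((hasDerivAt_id z).sub_const _).inv h0 using 1
    simp [neg_div]
  have h := Complex.hasSum_deriv_of_summable_norm (U := ball w δ) (z := w)
    (F := fun (x : {x : ℝ // f x = 0}) (z : ℂ) => (z - ((x : ℝ) : ℂ))⁻¹)
    (hf.summable_inv.mul_left K)
    (fun x z hz => (hd x z hz).differentiableAt.differentiableWithinAt) isOpen_ball
    (fun x z hz => hK z hz x) (mem_ball_self hδ)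
  rw [(funext fun x => (hd x w (mem_ball_self hδ)).deriv :
    (fun x : {x : ℝ // f x = 0} => deriv (fun z : ℂ => (z - ((x : ℝ) : ℂ))⁻¹) w) = _)] at h
  convert! h using 1
  refine Filter.EventuallyEq.deriv_eq ?_
  filter_upwards [isOpen_ball.mem_nhds (mem_ball_self hδ)] with z hz
  exact (hf.hasSum_logDeriv (hne z hz)).tsum_eq.symm

/-- The operator `α + w d/dw - β w` preserves the positivity and simplicity of the zeros. -/
theorem zeros_laguerre (hf : PosSimpleZeros f) {α β : ℝ} (hα : 0 < α) (hβ : 0 ≤ β) {w : ℂ}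
    (hw : α * f w + w * deriv f w - β * w * f w = 0) :
    ∃ x : ℝ, 0 < x ∧ w = x ∧
      deriv (fun z => α * f z + z * deriv f z - β * z * f z) w ≠ 0 := by
  have hw0 : w ≠ 0 := by
    rintro rfl
    simp [hf.map_zero, hα.ne'] at hw
  have hfw : f w ≠ 0 := by
    intro h
    obtain ⟨x, -, -, hd⟩ := hf.zeros w h
    simp [h, hw0, hd] at hw
  have hne : ∀ x : {x : ℝ // f x = 0}, w - ((x : ℝ) : ℂ) ≠ 0 := fun x h =>
    hfw (by rw [sub_eq_zero.1 h]; exact x.2)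
  have hS := hf.hasSum_logDeriv hfw
  have hfd : deriv f w = f w * logDeriv f w := by
    rw [logDeriv_apply]; field_simp
  have hF : (α : ℂ) + w * logDeriv f w - β * w = 0 := by
    have : f w * ((α : ℂ) + w * logDeriv f w - β * w) = 0 := by
      rw [← hw, hfd]; ring
    exact (mul_eq_zero.1 this).resolve_left hfw
  -- Without zeros f'/f = 0, and the equation becomes α = βw with α > 0.
  have hemp : IsEmpty {x : ℝ // f x = 0} → β ≠ 0 := by
    rintro h rfl
    have h0 : logDeriv f w = 0 := hS.unique hasSum_empty
    simp [h0, hα.ne'] at hF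
  -- A vanishing weighted sum of positive terms is impossible.
  have hpos : ∀ t : {x : ℝ // f x = 0} → ℝ, (∀ x, 0 < t x) → ∀ s, HasSum t s → s + β ≠ 0 := by
    intro t ht s hs h
    have hs0 : 0 ≤ s := hs.nonneg fun x => (ht x).le
    have hβ0 : β = 0 := by linarith
    have hs00 : s = 0 := by linarith
    rcases isEmpty_or_nonempty {x : ℝ // f x = 0} with he | ⟨⟨x⟩⟩
    · exact hemp he hβ0
    · have := le_hasSum hs x fun y _ => (ht y).le
      linarith [ht x]
  -- Im (w/(w - x)) = -Im w · x/|w - x|². Dividing the imaginary part of the equation by -Im w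
  -- leaves a sum of positive terms plus β, equal to 0.
  have him : w.im = 0 := by
    by_contra him
    have h1 := Complex.hasSum_im (hS.mul_left w)
    have h2 : ∀ x : {x : ℝ // f x = 0}, (w * (w - ((x : ℝ) : ℂ))⁻¹).im =
        -w.im * ((x : ℝ) / Complex.normSq (w - ((x : ℝ) : ℂ))) := fun x => by
      simp only [Complex.mul_im, Complex.inv_re, Complex.inv_im, Complex.sub_re, Complex.sub_im,
        Complex.ofReal_re, Complex.ofReal_im]
      ring
    simp only [h2] at h1
    have h3 := h1.mul_left (-w.im)⁻¹
    simp only [inv_mul_cancel_left₀ (neg_ne_zero.2 him)] at h3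
    refine hpos _ (fun x => div_pos (hf.pos x.2) (Complex.normSq_pos.2 (hne x))) _ h3 ?_
    have h4 := congrArg Complex.im hF
    simp only [Complex.sub_im, Complex.add_im, Complex.ofReal_im, Complex.zero_im,
      Complex.im_ofReal_mul, zero_add] at h4
    field_simp
    linarith
  obtain ⟨y, rfl⟩ : ∃ y : ℝ, w = y := ⟨w.re, by apply Complex.ext <;> simp [him]⟩
  have hyx : ∀ x : {x : ℝ // f x = 0}, y - (x : ℝ) ≠ 0 := fun x h => hne x (by exact_mod_cast h)
  refine ⟨y, ?_, rfl, ?_⟩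
  -- For y ≤ 0 each y/(y - x) is nonnegative, so the left side of the equation is at least α.
  · by_contra! hy
    have h1 := Complex.hasSum_re (hS.mul_left (y : ℂ))
    have h2 : ∀ x : {x : ℝ // f x = 0}, ((y : ℂ) * ((y : ℂ) - ((x : ℝ) : ℂ))⁻¹).re =
        y * (y - (x : ℝ))⁻¹ := fun x => by norm_cast
    simp only [h2] at h1
    have h3 := h1.nonneg fun x => mul_nonneg_of_nonpos_of_nonpos hy
      (inv_nonpos.2 (by linarith [hf.pos x.2]))
    have h4 := congrArg Complex.re hF
    simp only [Complex.sub_re, Complex.add_re, Complex.ofReal_re, Complex.zero_re,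
      Complex.re_ofReal_mul] at h4 h3
    nlinarith
  -- Let F = α + z f'/f - βz. Then -F' = ∑ x/(y - x)² + β is nonzero, and where F = 0 the derivative
  -- of fF is fF'.
  · have hT := hf.hasSum_deriv_logDeriv hfw
    have hsum : HasSum (fun x : {x : ℝ // f x = 0} => (((x : ℝ) / (y - (x : ℝ)) ^ 2 : ℝ) : ℂ))
        (-(logDeriv f y + y * deriv (logDeriv f) y)) := by
      convert! (hS.add (hT.mul_left (y : ℂ))).neg using 2 with x
      have h0 := hne x
      push_cast
      field_simp
      ring
    have hr : -(logDeriv f y + y * deriv (logDeriv f) y) =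
        ((-(logDeriv f y + y * deriv (logDeriv f) y)).re : ℂ) := by
      refine hsum.unique ?_
      have := Complex.hasSum_ofReal.2 (Complex.hasSum_re hsum)
      simpa only [Complex.ofReal_re] using this
    have hsum' := Complex.hasSum_re hsum
    simp only [Complex.ofReal_re] at hsum'
    have hne0 := hpos _ (fun x => div_pos (hf.pos x.2) (sq_pos_of_ne_zero (hyx x))) _ hsum'
    have hev : (fun z => α * f z + z * deriv f z - β * z * f z) =ᶠ[𝓝 (y : ℂ)]
        fun z => f z * (α + z * logDeriv f z - β * z) := by
      filter_upwards [hf.differentiable.continuous.continuousAt.eventually_ne hfw] with z hz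
      rw [logDeriv_apply]
      field_simp
    have hdl : DifferentiableAt ℂ (logDeriv f) y :=
      ((hf.differentiable.analyticAt _).deriv.differentiableAt).div (hf.differentiable _) hfw
    have hD : HasDerivAt (fun z => f z * (α + z * logDeriv f z - β * z))
        (deriv f y * (α + y * logDeriv f y - β * y) +
          f y * ((1 * logDeriv f y + y * deriv (logDeriv f) y) - β * 1)) y :=
      (hf.differentiable _).hasDerivAt.mul
        ((((hasDerivAt_id (y : ℂ)).mul hdl.hasDerivAt).const_add _).sub
          ((hasDerivAt_id (y : ℂ)).const_mul _))
    rw [hev.deriv_eq, hD.deriv, hF, mul_zero, zero_add]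
    refine mul_ne_zero hfw fun h => hne0 ?_
    have h5 : -(logDeriv f y + y * deriv (logDeriv f) y) + β = 0 := by linear_combination -h
    rw [hr] at h5
    exact_mod_cast h5

end PosSimpleZeros

/-! ### Power series with rapidly decaying coefficients -/

/-- Real coefficients decaying like those of an entire function of order one half. -/
def FastDecay (u : ℕ → ℝ) : Prop :=
  ∃ C D : ℝ, 0 ≤ C ∧ 0 ≤ D ∧ ∀ n, |u n| ≤ C * D ^ n / (n.factorial : ℝ) ^ 2

/-- The sum of the power series with real coefficients `u`. -/
noncomputable def powerSum (u : ℕ → ℝ) (w : ℂ) : ℂ := ∑' n, (u n : ℂ) * w ^ n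

namespace FastDecay

variable {u v : ℕ → ℝ}

lemma add (hu : FastDecay u) (hv : FastDecay v) : FastDecay fun n => u n + v n := by
  obtain ⟨C, D, hC, hD, h⟩ := hu
  obtain ⟨C', D', hC', hD', h'⟩ := hv
  refine ⟨C + C', max D D', by positivity, by positivity, fun n => ?_⟩
  calc |u n + v n| ≤ |u n| + |v n| := abs_add_le _ _
    _ ≤ C * D ^ n / (n.factorial : ℝ) ^ 2 + C' * D' ^ n / (n.factorial : ℝ) ^ 2 :=
        add_le_add (h n) (h' n)
    _ ≤ C * max D D' ^ n / (n.factorial : ℝ) ^ 2 +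
          C' * max D D' ^ n / (n.factorial : ℝ) ^ 2 := by
        gcongr
        · exact le_max_left _ _
        · exact le_max_right _ _
    _ = _ := by ring

lemma const_mul (hu : FastDecay u) (k : ℝ) : FastDecay fun n => k * u n := by
  obtain ⟨C, D, hC, hD, h⟩ := hu
  refine ⟨|k| * C, D, by positivity, hD, fun n => ?_⟩
  rw [abs_mul, mul_assoc, mul_div_assoc]
  gcongr
  exact h n

lemma natCast_mul (hu : FastDecay u) : FastDecay fun n => n * u n := by
  obtain ⟨C, D, hC, hD, h⟩ := hu
  refine ⟨C, 2 * D, hC, by positivity, fun n => ?_⟩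
  rw [abs_mul, Nat.abs_cast]
  calc (n : ℝ) * |u n| ≤ 2 ^ n * (C * D ^ n / (n.factorial : ℝ) ^ 2) := by
        gcongr
        · exact_mod_cast n.lt_two_pow_self.le
        · exact h n
    _ = _ := by rw [mul_pow]; ring

lemma shift (hu : FastDecay u) : FastDecay fun n => (n + 1) * u (n + 1) := by
  obtain ⟨C, D, hC, hD, h⟩ := hu
  refine ⟨C * D, D, by positivity, hD, fun n => ?_⟩
  rw [abs_mul, abs_of_nonneg (by positivity : (0 : ℝ) ≤ n + 1)]
  calc ((n : ℝ) + 1) * |u (n + 1)| ≤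
        (n + 1) * (C * D ^ (n + 1) / ((n + 1).factorial : ℝ) ^ 2) := by
        gcongr
        exact h (n + 1)
    _ = C * D * D ^ n / (n.factorial : ℝ) ^ 2 * (1 / (n + 1)) := by
        rw [Nat.factorial_succ]; push_cast; field_simp; ring
    _ ≤ C * D * D ^ n / (n.factorial : ℝ) ^ 2 * 1 := by
        gcongr
        rw [div_le_one (by positivity)]
        linarith [n.cast_nonneg (α := ℝ)]
    _ = _ := mul_one _

/-- The majorant D^n r^n/n!² is the square of √(Dr)^n/n!. One factor is at most exp √(Dr), and the
other sums to exp √(Dr). -/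
lemma exists_hasSum_bound (hu : FastDecay u) : ∃ C D : ℝ, 0 ≤ C ∧ 0 ≤ D ∧ ∀ r : ℝ, 0 ≤ r →
    Summable (fun n => |u n| * r ^ n) ∧ ∑' n, |u n| * r ^ n ≤ C * Real.exp (D * √r) := by
  obtain ⟨C, D, hC, hD, h⟩ := hu
  refine ⟨C, 2 * √D, hC, by positivity, fun r hr => ?_⟩
  have hE : HasSum (fun n : ℕ => C * Real.exp √(D * r) * (√(D * r) ^ n / n.factorial))
      (C * Real.exp √(D * r) * Real.exp √(D * r)) := by
    have := NormedSpace.expSeries_div_hasSum_exp (√(D * r))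
    rw [← Real.exp_eq_exp_ℝ] at this
    exact this.mul_left _
  have hle : ∀ n, |u n| * r ^ n ≤ C * Real.exp √(D * r) * (√(D * r) ^ n / n.factorial) := by
    intro n
    calc |u n| * r ^ n ≤ C * D ^ n / (n.factorial : ℝ) ^ 2 * r ^ n := by
          gcongr
          exact h n
      _ = C * (√(D * r) ^ n / n.factorial) * (√(D * r) ^ n / n.factorial) := by
          have h1 : √(D * r) ^ n * √(D * r) ^ n = D ^ n * r ^ n := by
            rw [← mul_pow, Real.mul_self_sqrt (by positivity), mul_pow]
          field_simp
          rw [mul_assoc, ← h1]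
          ring
      _ ≤ C * Real.exp √(D * r) * (√(D * r) ^ n / n.factorial) := by
          gcongr
          exact Real.pow_div_factorial_le_exp _ (by positivity) n
  have hs : Summable fun n => |u n| * r ^ n :=
    Summable.of_nonneg_of_le (fun n => by positivity) hle hE.summable
  refine ⟨hs, (hasSum_le hle hs.hasSum hE).trans_eq ?_⟩
  rw [mul_assoc, ← Real.exp_add, Real.sqrt_mul hD]
  ring_nf

lemma summable_abs (hu : FastDecay u) {r : ℝ} (hr : 0 ≤ r) : Summable fun n => |u n| * r ^ n := by
  obtain ⟨C, D, -, -, h⟩ := hu.exists_hasSum_bound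
  exact (h r hr).1

lemma norm_term (u : ℕ → ℝ) (w : ℂ) (n : ℕ) : ‖(u n : ℂ) * w ^ n‖ = |u n| * ‖w‖ ^ n := by
  rw [norm_mul, norm_pow, Complex.norm_real, Real.norm_eq_abs]

lemma hasSum (hu : FastDecay u) (w : ℂ) :
    HasSum (fun n => (u n : ℂ) * w ^ n) (powerSum u w) :=
  (Summable.of_norm (by simpa only [norm_term] using hu.summable_abs (norm_nonneg w))).hasSum

lemma growth (hu : FastDecay u) :
    ∃ C : ℝ, 0 < C ∧ ∀ w, ‖powerSum u w‖ ≤ C * Real.exp (C * √‖w‖) := by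
  obtain ⟨C, D, hC, hD, h⟩ := hu.exists_hasSum_bound
  refine ⟨max C D + 1, by positivity, fun w => ?_⟩
  obtain ⟨h1, h2⟩ := h ‖w‖ (norm_nonneg w)
  calc ‖powerSum u w‖ ≤ ∑' n, ‖(u n : ℂ) * w ^ n‖ :=
        norm_tsum_le_tsum_norm (by simpa only [norm_term] using h1)
    _ ≤ C * Real.exp (D * √‖w‖) := by simpa only [norm_term] using h2
    _ ≤ _ := by
        gcongr
        · linarith [le_max_left C D]
        · linarith [le_max_right C D]

lemma hasDerivAt (hu : FastDecay u) (w : ℂ) :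
    HasDerivAt (powerSum u) (powerSum (fun n => (n + 1) * u (n + 1)) w) w := by
  have hb := hu.summable_abs (r := ‖w‖ + 1) (by positivity)
  have hle : ∀ (n : ℕ) (z : ℂ), z ∈ ball (0 : ℂ) (‖w‖ + 1) →
      ‖(u n : ℂ) * z ^ n‖ ≤ |u n| * (‖w‖ + 1) ^ n := fun n z hz => by
    rw [norm_term]
    rw [mem_ball_zero_iff] at hz
    gcongr
  have hw : w ∈ ball (0 : ℂ) (‖w‖ + 1) := by simp
  have hd := Complex.differentiableOn_tsum_of_summable_norm (F := fun n z => (u n : ℂ) * z ^ n)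
    hb (fun n => by fun_prop) isOpen_ball hle
  have hs := Complex.hasSum_deriv_of_summable_norm (F := fun n z => (u n : ℂ) * z ^ n)
    hb (fun n => by fun_prop) isOpen_ball hle hw
  have hs' := (hasSum_nat_add_iff' 1).2 hs
  simp only [Finset.range_one, Finset.sum_singleton, pow_zero, mul_one, deriv_const,
    sub_zero] at hs'
  have hval := (hu.shift.hasSum w).unique (by
    convert! hs' using 2 with n
    simp
    ring)
  rw [hval]
  exact (hd.differentiableAt (isOpen_ball.mem_nhds hw)).hasDerivAt

lemma differentiable (hu : FastDecay u) : Differentiable ℂ (powerSum u) :=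
  fun w => (hu.hasDerivAt w).differentiableAt

lemma deriv_eq (hu : FastDecay u) :
    deriv (powerSum u) = powerSum fun n => (n + 1) * u (n + 1) :=
  funext fun w => (hu.hasDerivAt w).deriv

lemma mul_deriv (hu : FastDecay u) (w : ℂ) :
    w * deriv (powerSum u) w = powerSum (fun n => n * u n) w := by
  have h1 := (hasSum_nat_add_iff' 1).2 (hu.natCast_mul.hasSum w)
  simp only [Finset.range_one, Finset.sum_singleton, Nat.cast_zero, zero_mul, Complex.ofReal_zero,
    sub_zero] at h1
  rw [hu.deriv_eq]
  refine ((hu.shift.hasSum w).mul_left w).unique ?_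
  convert! h1 using 2 with n
  push_cast
  ring

lemma powerSum_add (hu : FastDecay u) (hv : FastDecay v) (w : ℂ) :
    powerSum (fun n => u n + v n) w = powerSum u w + powerSum v w := by
  refine ((hu.add hv).hasSum w).unique ?_
  convert! (hu.hasSum w).add (hv.hasSum w) using 2 with n
  push_cast
  ring

end FastDecay

lemma powerSum_const_mul (u : ℕ → ℝ) (k : ℝ) (w : ℂ) :
    powerSum (fun n => k * u n) w = k * powerSum u w := by
  simp only [powerSum, ← tsum_mul_left]
  congr 1
  funext n
  push_cast
  ring

lemma powerSum_zero (u : ℕ → ℝ) : powerSum u 0 = u 0 := by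
  rw [powerSum, tsum_eq_single 0 (fun n hn => by simp [hn])]
  simp

lemma powerSum_ofReal (u : ℕ → ℝ) (x : ℝ) : powerSum u x = ((∑' n, u n * x ^ n : ℝ) : ℂ) := by
  rw [powerSum, Complex.ofReal_tsum]
  push_cast
  rfl

/-- A power series whose coefficients alternate in sign is positive on the negative half-line. -/
lemma FastDecay.powerSum_re_ge {u : ℕ → ℝ} (hu : FastDecay u) (hpos : ∀ n, 0 < (-1) ^ n * u n)
    {x : ℝ} (hx : x ≤ 0) (n : ℕ) : (-1) ^ n * u n * (-x) ^ n ≤ (powerSum u x).re := by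
  have h := Complex.hasSum_re (hu.hasSum x)
  have h2 : ∀ n, ((u n : ℂ) * (x : ℂ) ^ n).re = (-1) ^ n * u n * (-x) ^ n := fun n => by
    rw [mul_right_comm, ← mul_pow]
    norm_cast
    simp [mul_comm]
  simp only [h2] at h
  exact le_hasSum h n fun m _ => mul_nonneg (hpos m).le (pow_nonneg (by linarith) _)

/-! ### Positivity and simplicity of the zeros of the Bessel series -/

/-- The coefficients of `Γ(ν+1) (z/2)^(-ν) J_ν(z)` as a power series in `z²`. -/
noncomputable def besselCoeff (ν : ℝ) (n : ℕ) : ℝ :=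
  (-1) ^ n / (n.factorial * poch (ν + 1) n * 4 ^ n)

lemma poch_zero (x : ℝ) : poch x 0 = 1 := by simp [poch]

lemma poch_succ (x : ℝ) (n : ℕ) : poch x (n + 1) = poch x n * (x + n) := by
  simp [poch, ascPochhammer_succ_right]

lemma poch_pos {x : ℝ} (hx : 0 < x) (n : ℕ) : 0 < poch x n := ascPochhammer_pos n x hx

lemma factorial_le_poch {ν : ℝ} (hν : 0 ≤ ν) (n : ℕ) : (n.factorial : ℝ) ≤ poch (ν + 1) n := by
  induction n with
  | zero => simp [poch_zero]
  | succ n ih =>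
    rw [poch_succ, Nat.factorial_succ, mul_comm]
    push_cast
    exact mul_le_mul ih (by linarith) (by positivity) (poch_pos (by linarith) n).le

lemma fastDecay_besselCoeff {ν : ℝ} (hν : 0 ≤ ν) : FastDecay (besselCoeff ν) := by
  refine ⟨1, 1, by norm_num, by norm_num, fun n => ?_⟩
  have hp := poch_pos (x := ν + 1) (by linarith) n
  rw [besselCoeff, abs_div, abs_pow, abs_neg, abs_one, one_pow, one_mul, abs_of_pos (by positivity)]
  refine one_div_le_one_div_of_le (by positivity) ?_
  rw [sq]
  calc (n.factorial : ℝ) * n.factorial ≤ n.factorial * poch (ν + 1) n := by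
        gcongr; exact factorial_le_poch hν n
    _ ≤ n.factorial * poch (ν + 1) n * 4 ^ n :=
        le_mul_of_one_le_right (by positivity) (one_le_pow₀ (by norm_num))

lemma besselCoeff_zero (ν : ℝ) : besselCoeff ν 0 = 1 := by simp [besselCoeff, poch_zero]

lemma besselCoeff_sign {ν : ℝ} (hν : 0 ≤ ν) (n : ℕ) : 0 < (-1) ^ n * besselCoeff ν n := by
  have hp := poch_pos (x := ν + 1) (by linarith) n
  have : (-1 : ℝ) ^ n * (-1) ^ n = 1 := by rw [← mul_pow]; simp
  rw [besselCoeff, ← mul_div_assoc, this]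
  positivity

lemma besselCoeff_succ {ν : ℝ} (hν : 0 ≤ ν) (n : ℕ) :
    4 * ((n : ℝ) + 1) * (ν + 1 + n) * besselCoeff ν (n + 1) = -besselCoeff ν n := by
  have hp := (poch_pos (x := ν + 1) (by linarith) n).ne'
  have h1 : ν + 1 + n ≠ 0 := by positivity
  rw [besselCoeff, besselCoeff, poch_succ, Nat.factorial_succ]
  push_cast
  field_simp
  ring

/-- The differential equation `w g'' + (ν + 1) g' + g / 4 = 0`. -/
lemma besselCoeff_ode {ν : ℝ} (hν : 0 ≤ ν) (w : ℂ) :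
    w * deriv (deriv (powerSum (besselCoeff ν))) w + (ν + 1) * deriv (powerSum (besselCoeff ν)) w
      + powerSum (besselCoeff ν) w / 4 = 0 := by
  have hu := fastDecay_besselCoeff hν
  have h1 := hu.shift.natCast_mul
  have h2 := hu.shift.const_mul (ν + 1)
  have h3 := hu.const_mul (1 / 4)
  have h4 := (h1.add h2).powerSum_add h3 w
  rw [h1.powerSum_add h2, powerSum_const_mul, powerSum_const_mul] at h4
  have hz : ∀ n : ℕ, n * ((n + 1) * besselCoeff ν (n + 1)) +
      (ν + 1) * ((n + 1) * besselCoeff ν (n + 1)) + 1 / 4 * besselCoeff ν n = 0 := fun n => by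
    linear_combination besselCoeff_succ hν n / 4
  rw [hu.deriv_eq, hu.shift.mul_deriv]
  simp only [hz] at h4
  have h5 : powerSum (fun _ => 0) w = 0 := by simp [powerSum]
  rw [h5] at h4
  push_cast at h4
  rw [h4]
  ring

/-- A function with nonnegative derivative that returns to its initial value is stationary. -/
lemma deriv_eq_zero_of_return {H φ : ℝ → ℝ} {x : ℝ} (hx : 0 < x)
    (hc : ContinuousOn H (Set.Icc 0 x)) (hd : ∀ t ∈ Set.Ioo 0 x, HasDerivAt H (φ t) t)
    (hφ : ∀ t ∈ Set.Ioo 0 x, 0 ≤ φ t) (hH : H x = H 0) {t : ℝ} (ht : t ∈ Set.Ioo 0 x) :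
    φ t = 0 := by
  have hm : MonotoneOn H (Set.Icc 0 x) := by
    refine monotoneOn_of_deriv_nonneg (convex_Icc 0 x) hc ?_ ?_
    · rw [interior_Icc]
      exact fun s hs => (hd s hs).differentiableAt.differentiableWithinAt
    · rw [interior_Icc]
      intro s hs
      rw [(hd s hs).deriv]
      exact hφ s hs
  have hconst : H =ᶠ[𝓝 t] fun _ => H 0 := by
    filter_upwards [isOpen_Ioo.mem_nhds ht] with s hs
    have hs' := Set.Ioo_subset_Icc_self hs
    refine le_antisymm ?_ (hm (Set.left_mem_Icc.2 hx.le) hs' hs'.1)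
    exact (hm hs' (Set.right_mem_Icc.2 hx.le) hs'.2).trans hH.le
  rw [← (hd t ht).deriv, hconst.deriv_eq, deriv_const]

lemma exists_ne_zero_of_continuous {g : ℂ → ℂ} (hg : Continuous g) (h0 : g 0 ≠ 0) (w : ℂ) {x : ℝ}
    (hx : 0 < x) : ∃ t ∈ Set.Ioo 0 x, g (t * w) ≠ 0 := by
  have hc : ContinuousAt (fun t : ℝ => g (t * w)) 0 := by fun_prop
  have h1 : ∀ᶠ t : ℝ in 𝓝 0, g (t * w) ≠ 0 := hc.eventually_ne (by simpa using h0)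
  obtain ⟨t, h2, h3⟩ := ((h1.filter_mono nhdsWithin_le_nhds).and (Ioo_mem_nhdsGT hx)).exists
  exact ⟨t, h3, h2⟩

/-- Self-adjointness along the ray t ↦ tw: the quantity -Im w · t^(ν+1) · Im(w g'(tw) · conj g(tw))
has derivative (Im w)² t^ν |g(tw)|²/4, since the term |w g'|² is real and drops out. It vanishes at
t = 0 and, if g w = 0, at t = 1, so Im w ≠ 0 would force g = 0 along the ray, against g 0 = 1. -/
lemma im_eq_zero_of_powerSum_besselCoeff_eq_zero {ν : ℝ} (hν : 0 ≤ ν) {w : ℂ}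
    (hw : powerSum (besselCoeff ν) w = 0) : w.im = 0 := by
  by_contra him
  have hu := fastDecay_besselCoeff hν
  have hode := besselCoeff_ode hν
  have hg0 : powerSum (besselCoeff ν) 0 ≠ 0 := by simp [powerSum_zero, besselCoeff_zero]
  have hdg := hu.differentiable
  have hdg' : Differentiable ℂ (deriv (powerSum (besselCoeff ν))) :=
    hu.deriv_eq ▸ hu.shift.differentiable
  set g := powerSum (besselCoeff ν)
  set H : ℝ → ℝ := fun t =>
    -w.im * (t ^ (ν + 1) * (w * deriv g (t * w) * (starRingEnd ℂ) (g (t * w))).im)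
  have hline : ∀ t : ℝ, HasDerivAt (fun t : ℝ => (t : ℂ) * w) w t := fun t => by
    simpa using (Complex.ofRealCLM.hasDerivAt (x := t)).mul_const w
  have hd : ∀ t ∈ Set.Ioo (0 : ℝ) 1,
      HasDerivAt H (w.im ^ 2 * t ^ ν * Complex.normSq (g (t * w)) / 4) t := by
    intro t ht
    have h1 : HasDerivAt (fun t : ℝ => g (t * w)) (deriv g (t * w) * w) t :=
      (hdg _).hasDerivAt.comp t (hline t)
    have h2 : HasDerivAt (fun t : ℝ => deriv g (t * w)) (deriv (deriv g) (t * w) * w) t :=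
      (hdg' _).hasDerivAt.comp t (hline t)
    have h3 := (h2.const_mul w).mul h1.star
    have h4 := Complex.imCLM.hasFDerivAt.comp_hasDerivAt t h3
    have h5 := ((Real.hasDerivAt_rpow_const (p := ν + 1) (Or.inl ht.1.ne')).mul h4).const_mul
      (-w.im)
    convert! h5 using 1
    rw [add_sub_cancel_right, Real.rpow_add_one ht.1.ne']
    have h6 := hode (t * w)
    have h7 : (t : ℂ) * (w * (deriv (deriv g) (t * w) * w)) =
        -w * ((ν + 1) * deriv g (t * w) + g (t * w) / 4) := by linear_combination w * h6
    have h8 : t * (w * (deriv (deriv g) (t * w) * w) * (starRingEnd ℂ) (g (t * w))).im =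
        (-w * ((ν + 1) * deriv g (t * w) + g (t * w) / 4) * (starRingEnd ℂ) (g (t * w))).im := by
      rw [← h7, ← Complex.im_ofReal_mul]
      ring_nf
    have h9 : (w * deriv g (t * w) * star (deriv g (t * w) * w)).im = 0 := by
      rw [mul_comm w]
      exact Complex.ext_iff.1 (Complex.mul_conj _) |>.2.trans (by simp)
    have h10 : (-w * ((ν + 1) * deriv g (t * w) + g (t * w) / 4) *
        (starRingEnd ℂ) (g (t * w))).im =
        -(ν + 1) * (w * deriv g (t * w) * (starRingEnd ℂ) (g (t * w))).im
          - w.im * Complex.normSq (g (t * w)) / 4 := by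
      have : -w * ((ν + 1) * deriv g (t * w) + g (t * w) / 4) * (starRingEnd ℂ) (g (t * w)) =
          ((-(ν + 1) : ℝ) : ℂ) * (w * deriv g (t * w) * (starRingEnd ℂ) (g (t * w)))
            - ((Complex.normSq (g (t * w)) / 4 : ℝ) : ℂ) * w := by
        push_cast
        rw [Complex.normSq_eq_conj_mul_self]
        ring
      rw [this, Complex.sub_im, Complex.im_ofReal_mul, Complex.im_ofReal_mul]
      ring
    simp only [Complex.imCLM_apply, Complex.add_im, Function.comp_apply] at *
    rw [h9, add_zero]
    rw [h10] at h8
    simp only [← starRingEnd_apply] at *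
    linear_combination (w.im * t ^ ν) * h8
  have hc : ContinuousOn H (Set.Icc 0 1) := by
    have h1 : Continuous fun t : ℝ => t ^ (ν + 1) := Real.continuous_rpow_const (by linarith)
    have h2 := hdg.continuous
    have h3 := hdg'.continuous
    have : Continuous H := by
      refine (h1.mul (Complex.continuous_im.comp ?_)).const_mul _
      exact ((h3.comp (by fun_prop)).const_mul _).mul
        (Complex.continuous_conj.comp (h2.comp (by fun_prop)))
    exact this.continuousOn
  obtain ⟨t, ht, hgt⟩ := exists_ne_zero_of_continuous hdg.continuous hg0 w one_pos
  have h := deriv_eq_zero_of_return one_pos hc hd (fun t ht => by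
    have := ht.1
    have := Complex.normSq_nonneg (g (t * w))
    positivity) (by
      simp [H, hw, Real.zero_rpow (by linarith : ν + 1 ≠ 0)]) ht
  have h1 := ht.1
  have h2 := Complex.normSq_pos.2 hgt
  have : 0 < w.im ^ 2 * t ^ ν * Complex.normSq (g (t * w)) / 4 := by positivity
  exact this.ne' h

/-- The energy t^(2ν+1)(t g'² + g²/4) has derivative (2ν+1) t^(2ν) g²/4. It vanishes at 0, and would
vanish again at a double zero. -/
lemma deriv_powerSum_besselCoeff_ne_zero {ν : ℝ} (hν : 0 ≤ ν) {x : ℝ} (hx : 0 < x)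
    (hgx : powerSum (besselCoeff ν) x = 0) : deriv (powerSum (besselCoeff ν)) x ≠ 0 := by
  intro hgx'
  have hu := fastDecay_besselCoeff hν
  have hode := besselCoeff_ode hν
  have hg0 : powerSum (besselCoeff ν) 0 ≠ 0 := by simp [powerSum_zero, besselCoeff_zero]
  have hdg := hu.differentiable
  have hdg' : Differentiable ℂ (deriv (powerSum (besselCoeff ν))) :=
    hu.deriv_eq ▸ hu.shift.differentiable
  have hreal : ∀ t : ℝ, (powerSum (besselCoeff ν) t).im = 0 := fun t => by
    rw [powerSum_ofReal, Complex.ofReal_im]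
  set g := powerSum (besselCoeff ν)
  set P : ℂ → ℂ := fun z => z * deriv g z ^ 2 + g z ^ 2 / 4
  have hP : ∀ z, HasDerivAt P (-(2 * ν + 1) * deriv g z ^ 2) z := by
    intro z
    have h := ((hasDerivAt_id z).mul ((hdg' z).hasDerivAt.pow 2)).add
      (((hdg z).hasDerivAt.pow 2).div_const 4)
    convert! h using 1
    simp only [id, Pi.pow_apply]
    push_cast
    linear_combination (-2 * deriv g z) * hode z
  have hd : ∀ t ∈ Set.Ioo (0 : ℝ) x, HasDerivAt (fun t : ℝ => t ^ (2 * ν + 1) * (P t).re)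
      ((2 * ν + 1) * t ^ (2 * ν) * (g t).re ^ 2 / 4) t := by
    intro t ht
    have h1 := (Real.hasDerivAt_rpow_const (p := 2 * ν + 1) (Or.inl ht.1.ne')).mul
      (hP t).real_of_complex
    convert! h1 using 1
    rw [add_sub_cancel_right, Real.rpow_add_one ht.1.ne']
    have h2 : (-(2 * ν + 1) * deriv g t ^ 2 : ℂ).re = -(2 * ν + 1) * (deriv g t ^ 2).re := by
      rw [← Complex.re_ofReal_mul]
      push_cast
      rfl
    have h3 : (P t).re = t * (deriv g t ^ 2).re + (g t).re ^ 2 / 4 := by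
      have h4 : (g t ^ 2 / 4).re = (g t).re ^ 2 / 4 := by
        have : g t = ((g t).re : ℂ) := Complex.ext rfl (by simp [hreal t])
        rw [this]
        norm_cast
      simp only [P, Complex.add_re, Complex.re_ofReal_mul, h4]
    rw [h2, h3]
    ring
  have hPc : Continuous P := continuous_iff_continuousAt.2 fun z => (hP z).continuousAt
  have hc : Continuous fun t : ℝ => t ^ (2 * ν + 1) * (P t).re :=
    (Real.continuous_rpow_const (by linarith)).mul
      (Complex.continuous_re.comp (hPc.comp Complex.continuous_ofReal))
  obtain ⟨t, ht, hgt⟩ := exists_ne_zero_of_continuous hdg.continuous hg0 1 hx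
  rw [mul_one] at hgt
  have h := deriv_eq_zero_of_return hx hc.continuousOn hd (fun t ht => by
    have := ht.1
    positivity) (by
      simp [P, hgx, hgx', Real.zero_rpow (by linarith : 2 * ν + 1 ≠ 0)]) ht
  have h1 := ht.1
  have h2 : (g t).re ≠ 0 := fun h => hgt (Complex.ext h (hreal t))
  have : 0 < (2 * ν + 1) * t ^ (2 * ν) * (g t).re ^ 2 / 4 := by positivity
  exact this.ne' h

lemma posSimpleZeros_besselCoeff {ν : ℝ} (hν : 0 ≤ ν) :
    PosSimpleZeros (powerSum (besselCoeff ν)) where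
  differentiable := (fastDecay_besselCoeff hν).differentiable
  map_zero := by simp [powerSum_zero, besselCoeff_zero]
  growth := (fastDecay_besselCoeff hν).growth
  zeros w hw := by
    have him := im_eq_zero_of_powerSum_besselCoeff_eq_zero hν hw
    obtain ⟨x, rfl⟩ : ∃ x : ℝ, w = x := ⟨w.re, Complex.ext rfl (by simp [him])⟩
    -- On the nonpositive half-line every term is nonnegative and the constant term is 1.
    have hx : 0 < x := by
      by_contra! hx
      have h := (fastDecay_besselCoeff hν).powerSum_re_ge (besselCoeff_sign hν) hx 0
      rw [hw] at h
      simp [besselCoeff_zero] at h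
      linarith
    exact ⟨x, hx, rfl, deriv_powerSum_besselCoeff_ne_zero hν hx hw⟩

/-! ### From the Bessel series to the series of `N_ν` -/

lemma PosSimpleZeros.laguerre {u v : ℕ → ℝ} (hf : PosSimpleZeros (powerSum u)) (hv : FastDecay v)
    {α β : ℝ} (hα : 0 < α) (hβ : 0 ≤ β)
    (huv : ∀ w, α * powerSum v w =
      α * powerSum u w + w * deriv (powerSum u) w - β * w * powerSum u w) :
    PosSimpleZeros (powerSum v) where
  differentiable := hv.differentiable
  map_zero := by
    have h := huv 0
    have hα' : (α : ℂ) ≠ 0 := by exact_mod_cast hα.ne'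
    rw [hf.map_zero] at h
    simpa [hα'] using h
  growth := hv.growth
  zeros w hw := by
    obtain ⟨x, hx, hwx, hd⟩ := hf.zeros_laguerre hα hβ (w := w) (by rw [← huv, hw, mul_zero])
    refine ⟨x, hx, hwx, fun h => hd ?_⟩
    rw [← funext huv, deriv_const_mul _ (hv.differentiable w), h, mul_zero]

/-- Multiplication of the coefficients by `(α + n) / α`. -/
lemma PosSimpleZeros.natCast_add {u v : ℕ → ℝ} (hu : FastDecay u) (hf : PosSimpleZeros (powerSum u))
    {α : ℝ} (hα : 0 < α) (huv : ∀ n, v n = (α + n) / α * u n) :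
    FastDecay v ∧ PosSimpleZeros (powerSum v) := by
  have hv' : v = fun n => u n + 1 / α * (n * u n) := by
    funext n
    rw [huv]
    field_simp
  have hn := hu.natCast_mul.const_mul (1 / α)
  have hv : FastDecay v := hv' ▸ hu.add hn
  refine ⟨hv, hf.laguerre hv hα le_rfl fun w => ?_⟩
  have hα' : (α : ℂ) ≠ 0 := by exact_mod_cast hα.ne'
  rw [hv', hu.powerSum_add hn, powerSum_const_mul, hu.mul_deriv]
  push_cast
  field_simp
  ring

/-- The coefficients of `N_ν`, normalised to start with one. -/
noncomputable def quadCoeff (a b c ν : ℝ) (n : ℕ) : ℝ :=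
  quadQ a b c (ν + 2 * n) / quadQ a b c ν * besselCoeff ν n

/-- Taylor expansion of Q at ν: multiplying the n-th coefficient by n is θ = w d/dw, so the series
of N_ν is a quadratic in θ applied to the Bessel series. -/
lemma quadCoeff_eq {a b c ν : ℝ} (hQ : quadQ a b c ν ≠ 0) :
    quadCoeff a b c ν = fun n : ℕ => besselCoeff ν n +
      (((2 * a * (2 * ν - 1) + 2 * b) / quadQ a b c ν) * (n * besselCoeff ν n) +
        (4 * a / quadQ a b c ν) * (n * (n * besselCoeff ν n))) := by
  funext n
  rw [quadCoeff]
  field_simp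
  simp only [quadQ]
  ring

lemma fastDecay_quadCoeff {a b c ν : ℝ} (hν : 0 ≤ ν) (hQ : quadQ a b c ν ≠ 0) :
    FastDecay (quadCoeff a b c ν) := by
  have hu := fastDecay_besselCoeff hν
  rw [quadCoeff_eq hQ]
  exact hu.add ((hu.natCast_mul.const_mul _).add (hu.natCast_mul.natCast_mul.const_mul _))

/-- The Bessel equation as w g = -4(θ² + νθ) g, the form that eliminates θ². -/
lemma mul_powerSum_besselCoeff {ν : ℝ} (hν : 0 ≤ ν) (w : ℂ) :
    w * powerSum (besselCoeff ν) w =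
      -4 * (powerSum (fun n => n * (n * besselCoeff ν n)) w
        + ν * powerSum (fun n => n * besselCoeff ν n) w) := by
  have hu := fastDecay_besselCoeff hν
  have h1 := ((hu.natCast_mul.natCast_mul.hasSum w).add
    ((hu.natCast_mul.hasSum w).mul_left (ν : ℂ))).mul_left (-4)
  have h2 := (hasSum_nat_add_iff' 1).2 h1
  simp only [Finset.range_one, Finset.sum_singleton, Nat.cast_zero, zero_mul, Complex.ofReal_zero,
    add_zero, mul_zero, sub_zero] at h2
  refine ((hu.hasSum w).mul_left w).unique ?_
  convert! h2 using 2 with n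
  have h3 := congrArg (fun r : ℝ => (r : ℂ)) (besselCoeff_succ hν n)
  push_cast at h3 ⊢
  linear_combination w ^ (n + 1) * h3

theorem posSimpleZeros_quadCoeff {a b c ν : ℝ} (habc : (c = 0 ∧ a ≠ b) ∨ (0 < c ∧ a < b))
    (hν : 0 ≤ ν) (hroot : ∀ x : ℝ, quadQ a b c x = 0 → x ≤ ν) (hQ : quadQ a b c ν ≠ 0) :
    PosSimpleZeros (powerSum (quadCoeff a b c ν)) := by
  have hu := fastDecay_besselCoeff hν
  have hg := posSimpleZeros_besselCoeff hν
  have hba : b - a ≠ 0 := by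
    rcases habc with h | h
    · exact sub_ne_zero.2 h.2.symm
    · exact (sub_pos.2 h.2).ne'
  have hcba : 0 ≤ c / (b - a) := by
    rcases habc with h | h
    · simp [h.1]
    · exact (div_pos h.1 (sub_pos.2 h.2)).le
  have hQν : quadQ a b c ν / (2 * (b - a)) = (a / (b - a) * ν ^ 2 + ν + c / (b - a)) / 2 := by
    rw [quadQ]; field_simp; ring
  -- If the ratio is nonnegative, eliminating θ² turns the quadratic into Q(ν) + 2(b - a)θ - aw;
  -- division by 2(b - a) gives α and β.
  rcases le_or_gt 0 (a / (b - a)) with hs | hs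
  · have hα : 0 < quadQ a b c ν / (2 * (b - a)) := by
      refine lt_of_le_of_ne ?_ (div_ne_zero hQ (mul_ne_zero two_ne_zero hba)).symm
      rw [hQν]
      positivity
    have hβ : 0 ≤ a / (b - a) / 2 := by positivity
    refine hg.laguerre (fastDecay_quadCoeff hν hQ) hα hβ fun w => ?_
    rw [mul_assoc, mul_powerSum_besselCoeff hν, hu.mul_deriv,
      quadCoeff_eq hQ, hu.powerSum_add ((hu.natCast_mul.const_mul _).add
        (hu.natCast_mul.natCast_mul.const_mul _)), (hu.natCast_mul.const_mul _).powerSum_add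
        (hu.natCast_mul.natCast_mul.const_mul _), powerSum_const_mul, powerSum_const_mul]
    have hQ' : (quadQ a b c ν : ℂ) ≠ 0 := by exact_mod_cast hQ
    have hba' : (b - a : ℂ) ≠ 0 := by exact_mod_cast hba
    push_cast
    field_simp
    ring
  · have ha : a ≠ 0 := by rintro rfl; simp at hs
    -- This makes the discriminant (b - a)² - 4ac nonnegative, so Q has real roots r₁, r₂, and
    -- Q(ν+2n)/Q(ν) is the product of (αᵢ + n)/αᵢ with αᵢ = (ν - rᵢ)/2 > 0.
    have hac : a * c ≤ 0 := by
      rcases habc with h | h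
      · simp [h.1]
      · have : a < 0 := by
          by_contra! h'
          exact hs.not_ge (div_nonneg h' (sub_pos.2 h.2).le)
        nlinarith
    set s := √((b - a) ^ 2 - 4 * (a * c)) with hsdef
    have hs2 : s ^ 2 = (b - a) ^ 2 - 4 * (a * c) := Real.sq_sqrt (by nlinarith [sq_nonneg (b - a)])
    set r₁ := (-(b - a) + s) / (2 * a) with hr₁
    set r₂ := (-(b - a) - s) / (2 * a) with hr₂
    have hfac : ∀ x, quadQ a b c x = a * (x - r₁) * (x - r₂) := fun x => by
      have h1 : c = ((b - a) ^ 2 - s ^ 2) / (4 * a) := by rw [hs2]; field_simp; ring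
      rw [quadQ, h1, hr₁, hr₂]
      field_simp
      ring
    have h1 : 0 < (ν - r₁) / 2 := by
      refine half_pos (sub_pos.2 (lt_of_le_of_ne (hroot _ (by rw [hfac]; ring)) fun h => hQ ?_))
      rw [hfac, h]; ring
    have h2 : 0 < (ν - r₂) / 2 := by
      refine half_pos (sub_pos.2 (lt_of_le_of_ne (hroot _ (by rw [hfac]; ring)) fun h => hQ ?_))
      rw [hfac, h]; ring
    obtain ⟨hu₁, hf₁⟩ := hg.natCast_add hu h1 (fun n => rfl)
    refine (hf₁.natCast_add hu₁ h2 fun n => ?_).2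
    have h3 : ν - r₁ ≠ 0 := by linarith
    have h4 : ν - r₂ ≠ 0 := by linarith
    rw [quadCoeff, hfac, hfac]
    field_simp
    ring

/-- By the intermediate value theorem, a change of sign would put a root of Q at or beyond ν. -/
lemma quadQ_div_pos {a b c ν : ℝ} (hroot : ∀ x : ℝ, quadQ a b c x = 0 → x ≤ ν)
    (hQ : quadQ a b c ν ≠ 0) {x : ℝ} (hx : ν ≤ x) : 0 < quadQ a b c x / quadQ a b c ν := by
  by_contra! h
  have hc : Continuous fun y => quadQ a b c y / quadQ a b c ν := by
    simp only [quadQ]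
    fun_prop
  obtain ⟨y, hy, hy0⟩ := intermediate_value_Icc' hx hc.continuousOn
    (show (0 : ℝ) ∈ Set.Icc _ _ from ⟨h, by simp [hQ]⟩)
  have hy1 : quadQ a b c y = 0 := by simpa [hQ] using hy0
  exact hQ (le_antisymm (hroot y hy1) hy.1 ▸ hy1)

lemma quadCoeff_sign {a b c ν : ℝ} (hν : 0 ≤ ν) (hroot : ∀ x : ℝ, quadQ a b c x = 0 → x ≤ ν)
    (hQ : quadQ a b c ν ≠ 0) (n : ℕ) : 0 < (-1) ^ n * quadCoeff a b c ν n := by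
  have h1 := quadQ_div_pos hroot hQ (x := ν + 2 * n) (by linarith [n.cast_nonneg (α := ℝ)])
  have h2 := besselCoeff_sign hν n
  rw [quadCoeff, mul_left_comm]
  positivity

/-! ### `N_ν` as a power series in `z²` -/

/-- The function `(z / 2) ^ ν ∑ uₙ z ^ (2 n)`. -/
noncomputable def frobeniusSum (ν : ℝ) (u : ℕ → ℝ) (z : ℂ) : ℂ :=
  (z / 2) ^ (ν : ℂ) * powerSum u (z ^ 2)

lemma Gamma_add_natCast {ν : ℝ} (hν : 0 ≤ ν) (n : ℕ) :
    Real.Gamma (n + ν + 1) = poch (ν + 1) n * Real.Gamma (ν + 1) := by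
  induction n with
  | zero => simp [poch_zero]
  | succ n ih =>
    have h : (0 : ℝ) < n + ν + 1 := by positivity
    rw [show ((n + 1 : ℕ) : ℝ) + ν + 1 = (n + ν + 1) + 1 by push_cast; ring,
      Real.Gamma_add_one h.ne', ih, poch_succ]
    ring

lemma besselJ_eq {ν : ℝ} (hν : 0 ≤ ν) {z : ℂ} (hz : z ≠ 0) :
    besselJ ν z = ((Real.Gamma (ν + 1))⁻¹ : ℝ) * frobeniusSum ν (besselCoeff ν) z := by
  rw [besselJ, frobeniusSum, powerSum, ← mul_assoc, ← tsum_mul_left]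
  refine tsum_congr fun n => ?_
  have hG : Complex.Gamma ((n : ℂ) + (ν : ℂ) + 1) =
      ((poch (ν + 1) n * Real.Gamma (ν + 1) : ℝ) : ℂ) := by
    rw [← Gamma_add_natCast hν, ← Complex.Gamma_ofReal]
    push_cast
    rfl
  have hpow : (z / 2) ^ (2 * (n : ℂ) + (ν : ℂ)) = (z ^ 2) ^ n / 4 ^ n * (z / 2) ^ (ν : ℂ) := by
    rw [Complex.cpow_add _ _ (div_ne_zero hz two_ne_zero)]
    congr 1
    rw [show (2 * (n : ℂ)) = ((2 * n : ℕ) : ℂ) by push_cast; rfl, Complex.cpow_natCast, pow_mul,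
      div_pow, div_pow]
    norm_num
  rw [hG, hpow, besselCoeff]
  have h1 : (poch (ν + 1) n : ℂ) ≠ 0 := by exact_mod_cast (poch_pos (by linarith) n).ne'
  have h2 : (Real.Gamma (ν + 1) : ℂ) ≠ 0 := by
    exact_mod_cast (Real.Gamma_pos_of_pos (by linarith)).ne'
  push_cast
  field_simp

/-- Here z d/dz multiplies the n-th coefficient by ν + 2n; the slit plane is where the principal
power is holomorphic. -/
lemma hasDerivAt_frobeniusSum {ν : ℝ} {u : ℕ → ℝ} (hu : FastDecay u) {z : ℂ}
    (hz : z ∈ Complex.slitPlane) :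
    HasDerivAt (frobeniusSum ν u) (frobeniusSum ν (fun n => ν * u n + 2 * (n * u n)) z / z) z := by
  have hz0 : z ≠ 0 := Complex.slitPlane_ne_zero hz
  have hz2 : z / 2 ∈ Complex.slitPlane := by
    rw [Complex.mem_slitPlane_iff] at *
    simpa [Complex.div_ofNat_re, Complex.div_ofNat_im] using hz
  have h1 := ((hasDerivAt_id z).div_const 2).cpow_const (c := (ν : ℂ)) hz2
  have h2 := (hu.differentiable (z ^ 2)).hasDerivAt.comp z (hasDerivAt_pow 2 z)
  convert! h1.mul h2 using 1
  rw [frobeniusSum, (hu.const_mul ν).powerSum_add (hu.natCast_mul.const_mul 2), powerSum_const_mul,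
    powerSum_const_mul, ← hu.mul_deriv]
  simp only [id, Function.comp_apply]
  rw [Complex.cpow_sub _ _ (div_ne_zero hz0 two_ne_zero), Complex.cpow_one]
  field_simp
  push_cast
  ring

/-- `N_ν` in terms of an entire function of `z²`. -/
lemma besselN_eq {a b c ν : ℝ} (hν : 0 ≤ ν) (hQ : quadQ a b c ν ≠ 0) {z : ℂ}
    (hz : z ∈ Complex.slitPlane) :
    besselN a b c ν z = ((Real.Gamma (ν + 1))⁻¹ * quadQ a b c ν : ℝ) *
      frobeniusSum ν (quadCoeff a b c ν) z := by
  have hz0 : z ≠ 0 := Complex.slitPlane_ne_zero hz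
  have hu := fastDecay_besselCoeff hν
  set k : ℂ := (((Real.Gamma (ν + 1))⁻¹ : ℝ) : ℂ)
  set u₁ : ℕ → ℝ := fun n => ν * besselCoeff ν n + 2 * (n * besselCoeff ν n) with hu₁def
  have hu₁ : FastDecay u₁ := (hu.const_mul ν).add (hu.natCast_mul.const_mul 2)
  set u₂ : ℕ → ℝ := fun n => ν * u₁ n + 2 * (n * u₁ n) with hu₂def
  have hu₂ : FastDecay u₂ := (hu₁.const_mul ν).add (hu₁.natCast_mul.const_mul 2)
  have hd1 : ∀ y ∈ Complex.slitPlane, deriv (besselJ ν) y = k * (frobeniusSum ν u₁ y / y) := by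
    intro y hy
    have hev : besselJ ν =ᶠ[𝓝 y] fun y => k * frobeniusSum ν (besselCoeff ν) y := by
      filter_upwards [Complex.isOpen_slitPlane.mem_nhds hy] with x hx
      exact besselJ_eq hν (Complex.slitPlane_ne_zero hx)
    rw [hev.deriv_eq]
    exact ((hasDerivAt_frobeniusSum hu hy).const_mul k).deriv
  have hd2 : deriv (deriv (besselJ ν)) z =
      k * ((frobeniusSum ν u₂ z / z * z - frobeniusSum ν u₁ z * 1) / z ^ 2) := by
    have hev : deriv (besselJ ν) =ᶠ[𝓝 z] fun y => k * (frobeniusSum ν u₁ y / y) := by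
      filter_upwards [Complex.isOpen_slitPlane.mem_nhds hz] with x hx
      exact hd1 x hx
    rw [hev.deriv_eq]
    exact (((hasDerivAt_frobeniusSum hu₁ hz).div (hasDerivAt_id z) hz0).const_mul k).deriv
  -- Q(x) = a x² + (b - a) x + c, matching a z²D² + b zD + c = a(zD)² + (b - a) zD + c.
  have hq : (fun n => quadQ a b c ν * quadCoeff a b c ν n) =
      fun n => a * u₂ n + ((b - a) * u₁ n + c * besselCoeff ν n) := by
    funext n
    rw [quadCoeff, hu₂def, hu₁def]
    field_simp
    simp only [quadQ]
    ring
  have hN : quadQ a b c ν * powerSum (quadCoeff a b c ν) (z ^ 2) =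
      a * powerSum u₂ (z ^ 2) + ((b - a) * powerSum u₁ (z ^ 2)
        + c * powerSum (besselCoeff ν) (z ^ 2)) := by
    rw [← powerSum_const_mul, hq, (hu₂.const_mul a).powerSum_add
      ((hu₁.const_mul (b - a)).add (hu.const_mul c)), (hu₁.const_mul (b - a)).powerSum_add
      (hu.const_mul c), powerSum_const_mul, powerSum_const_mul, powerSum_const_mul]
    push_cast
    rfl
  rw [besselN, hd2, hd1 z hz, besselJ_eq hν hz0]
  rw [Complex.ofReal_mul]
  change _ = k * _ * _
  have : k * (quadQ a b c ν : ℂ) * frobeniusSum ν (quadCoeff a b c ν) z =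
      k * (z / 2) ^ (ν : ℂ) * (quadQ a b c ν * powerSum (quadCoeff a b c ν) (z ^ 2)) := by
    rw [frobeniusSum]; ring
  rw [this, hN]
  change _ * (k * _) + _ * (k * _) + _ * (k * _) = _
  simp only [frobeniusSum]
  field_simp
  ring

lemma besselN_eq_zero_iff {a b c ν : ℝ} (hν : 0 ≤ ν) (hQ : quadQ a b c ν ≠ 0) {x : ℝ}
    (hx : 0 < x) : besselN a b c ν x = 0 ↔ powerSum (quadCoeff a b c ν) ((x ^ 2 : ℝ) : ℂ) = 0 := by
  rw [besselN_eq hν hQ (Complex.ofReal_mem_slitPlane.2 hx), frobeniusSum]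
  have h1 : ((Real.Gamma (ν + 1))⁻¹ * quadQ a b c ν : ℝ) ≠ 0 :=
    mul_ne_zero (inv_ne_zero (Real.Gamma_pos_of_pos (by linarith)).ne') hQ
  have h2 : ((x : ℂ) / 2) ^ (ν : ℂ) ≠ 0 := by
    rw [Ne, Complex.cpow_eq_zero_iff]
    simp [hx.ne']
  rw [mul_eq_zero, mul_eq_zero, or_iff_right (by exact_mod_cast h1), or_iff_right h2]
  push_cast
  rfl

/-! ### Symmetric functions of summable families -/

lemma eq_of_forall_hasSum_pow {p q : ℕ → ℂ} {f : ℂ → ℂ}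
    (hp : ∀ w, HasSum (fun n => p n * w ^ n) (f w))
    (hq : ∀ w, HasSum (fun n => q n * w ^ n) (f w)) : p = q := by
  have h : ∀ r : ℕ → ℂ, (∀ w, HasSum (fun n => r n * w ^ n) (f w)) →
      HasFPowerSeriesAt f (FormalMultilinearSeries.ofScalars ℂ r) 0 := fun r hr =>
    hasFPowerSeriesAt_iff.2 (Eventually.of_forall fun z => by
      simpa [FormalMultilinearSeries.coeff_ofScalars, mul_comm] using hr z)
  have := (h p hp).eq_formalMultilinearSeries (h q hq)
  funext n
  simpa [FormalMultilinearSeries.coeff_ofScalars] using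
    congrArg (fun s => FormalMultilinearSeries.coeff s n) this

/-- The elementary symmetric sums of a summable family are the coefficients of its product. -/
lemma hasSum_esymm {ι : Type*} {x : ι → ℝ} (hx : ∀ i, 0 ≤ x i) (hs : Summable x) {v : ℕ → ℝ}
    (hv : FastDecay v)
    (hprod : ∀ w : ℂ, HasProd (fun i => 1 - w * (x i : ℂ)) (powerSum v w)) (n : ℕ) :
    HasSum (fun s : {s : Finset ι // s.card = n} => ∏ i ∈ s.1, x i) ((-1) ^ n * v n) := by
  set X : Finset ι → ℝ := fun s => ∏ i ∈ s, x i
  have hX : Summable X := summable_finsetProd_of_summable_norm (hs.congr fun i => by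
    rw [Real.norm_of_nonneg (hx i)])
  have hfib : ∀ n, Summable fun s : {s : Finset ι // s.card = n} => X s.1 := fun n =>
    hX.subtype _
  set E : ℕ → ℝ := fun n => ∑' s : {s : Finset ι // s.card = n}, X s.1
  have key : ∀ w : ℂ, HasSum (fun n => ((-1) ^ n * (E n : ℂ)) * w ^ n) (powerSum v w) := by
    intro w
    have h1 : Summable fun s : Finset ι => ∏ i ∈ s, -(w * (x i : ℂ)) :=
      summable_finsetProd_of_summable_norm ((hs.mul_left ‖w‖).congr fun i => by
        rw [norm_neg, norm_mul, Complex.norm_real, Real.norm_of_nonneg (hx i)])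
    have h2 : HasSum (fun s : Finset ι => ∏ i ∈ s, -(w * (x i : ℂ))) (powerSum v w) := by
      have h3 := hasProd_one_add_of_hasSum_prod h1.hasSum
      have h4 := hprod w
      simp only [sub_eq_add_neg] at h4
      rw [← h3.unique h4]
      exact h1.hasSum
    -- Grouping the finite subsets by cardinality turns the expanded product into a power series in
    -- w.
    have h5 := ((Equiv.sigmaFiberEquiv (Finset.card : Finset ι → ℕ)).hasSum_iff.2 h2)
    refine h5.sigma fun n => ?_
    have h6 := (Complex.hasSum_ofReal.2 (hfib n).hasSum).mul_left ((-w) ^ n)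
    convert! h6 using 1
    · funext s
      obtain ⟨s, hs⟩ := s
      change ∏ i ∈ s, -(w * (x i : ℂ)) = (-w) ^ n * ((X s : ℝ) : ℂ)
      simp only [X, Complex.ofReal_prod, ← neg_mul, Finset.prod_mul_distrib, Finset.prod_const, hs]
    · rw [neg_pow]
      ring
  have h := congrFun (eq_of_forall_hasSum_pow key hv.hasSum) n
  have h' : (-1) ^ n * E n = v n := by exact_mod_cast h
  have hsq : (-1 : ℝ) ^ n * (-1) ^ n = 1 := by rw [← mul_pow]; simp
  rw [← h', ← mul_assoc, hsq, one_mul]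
  exact (hfib n).hasSum

lemma summable_pow_of_nonneg {ι : Type*} {x : ι → ℝ} (hx : ∀ i, 0 ≤ x i) (hs : Summable x) (n : ℕ) :
    Summable fun i => x i ^ (n + 1) := by
  refine Summable.of_nonneg_of_le (fun i => pow_nonneg (hx i) _) (fun i => ?_)
    (hs.mul_left ((∑' i, x i) ^ n))
  rw [pow_succ]
  have := hs.le_tsum i fun j _ => hx j
  have := hx i
  gcongr

open Finset in
lemma newton_finset {ι : Type*} (x : ι → ℝ) (T : Finset ι) (n : ℕ) :
    n * ∑ s ∈ T.powersetCard n, ∏ i ∈ s, x i = (-1) ^ (n + 1) *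
      ∑ a ∈ antidiagonal n with a.1 < n,
        (-1) ^ a.1 * (∑ s ∈ T.powersetCard a.1, ∏ i ∈ s, x i) * ∑ i ∈ T, x i ^ a.2 := by
  have he : ∀ k, MvPolynomial.aeval (fun i : T => x i) (MvPolynomial.esymm T ℝ k) =
      ∑ s ∈ T.powersetCard k, ∏ i ∈ s, x i := fun k => by
    rw [MvPolynomial.aeval_esymm_eq_multiset_esymm, ← Finset.esymm_map_val x T k]
    congr 1
    conv_rhs => rw [← Multiset.attach_map_val T.val]
    rw [Multiset.map_map]
    rfl
  have hp : ∀ k, MvPolynomial.aeval (fun i : T => x i) (MvPolynomial.psum T ℝ k) =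
      ∑ i ∈ T, x i ^ k := fun k => by
    rw [MvPolynomial.psum, map_sum]
    simp only [map_pow, MvPolynomial.aeval_X]
    exact Finset.sum_coe_sort T fun i => x i ^ k
  have h := congrArg (MvPolynomial.aeval (fun i : T => x i)) (MvPolynomial.mul_esymm_eq_sum T ℝ n)
  simpa only [map_mul, map_natCast, map_pow, map_neg, map_one, map_sum, he, hp] using h

/-- Newton's identities for a summable family. -/
lemma newton_hasSum {ι : Type*} {x : ι → ℝ} (hx : ∀ i, 0 ≤ x i) (hs : Summable x) {E : ℕ → ℝ}
    (hE : ∀ n, HasSum (fun s : {s : Finset ι // s.card = n} => ∏ i ∈ s.1, x i) (E n)) (n : ℕ) :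
    n * E n = (-1) ^ (n + 1) * ∑ a ∈ Finset.HasAntidiagonal.antidiagonal n with a.1 < n,
        (-1) ^ a.1 * E a.1 * ∑' i, x i ^ a.2 := by
  have he : ∀ k, Tendsto (fun T : Finset ι => ∑ s ∈ T.powersetCard k, ∏ i ∈ s, x i) atTop
      (𝓝 (E k)) := fun k => by
    have h1 := (hasSum_subtype_iff_indicator (f := fun s : Finset ι => ∏ i ∈ s, x i)
      (s := {s | s.card = k})).1 (hE k)
    have h2 : Tendsto _ _ _ := h1
    -- The unordered sum over all finite sets is evaluated along the powersets of T.
    refine (h2.comp tendsto_finset_powerset_atTop_atTop).congr fun T => ?_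
    rw [Function.comp_apply, Finset.powersetCard_eq_filter, Finset.sum_filter]
    refine Finset.sum_congr rfl fun s _ => ?_
    simp [Set.indicator_apply]
  have hp : ∀ k, Tendsto (fun T : Finset ι => ∑ i ∈ T, x i ^ (k + 1)) atTop
      (𝓝 (∑' i, x i ^ (k + 1))) := fun k => (summable_pow_of_nonneg hx hs k).hasSum
  refine tendsto_nhds_unique ((he n).const_mul (n : ℝ)) ?_
  simp only [newton_finset]
  refine (tendsto_finsetSum _ fun a ha => ?_).const_mul _
  obtain ⟨ha1, ha2⟩ := Finset.mem_filter.1 ha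
  rw [Finset.HasAntidiagonal.mem_antidiagonal] at ha1
  -- The condition a.1 < n excludes the zeroth power sum, which would count the elements of T.
  obtain ⟨k, hk⟩ : ∃ k, a.2 = k + 1 := ⟨a.2 - 1, by omega⟩
  rw [hk]
  exact ((he _).const_mul _).mul (hp k)

/-- Strictly increasing `n`-tuples of natural numbers are the same as `n`-element sets. -/
noncomputable def finsetEquivStrictMono (n : ℕ) :
    {s : Finset ℕ // s.card = n} ≃ {k : Fin n → ℕ // StrictMono k} where
  toFun s := ⟨s.1.orderEmbOfFin s.2, (s.1.orderEmbOfFin s.2).strictMono⟩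
  invFun k := ⟨Finset.univ.image k.1, by
    rw [Finset.card_image_of_injective _ k.2.injective, Finset.card_univ, Fintype.card_fin]⟩
  left_inv s := Subtype.ext (Finset.image_orderEmbOfFin_univ s.1 s.2)
  right_inv k := Subtype.ext (Finset.orderEmbOfFin_unique _
    (fun i => Finset.mem_image_of_mem _ (Finset.mem_univ i)) k.2).symm

lemma hasSum_strictMono {x : ℕ → ℝ} {n : ℕ} {e : ℝ}
    (h : HasSum (fun s : {s : Finset ℕ // s.card = n} => ∏ i ∈ s.1, x i) e) :
    HasSum (fun k : {k : Fin n → ℕ // StrictMono k} => ∏ i, x (k.1 i)) e := by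
  rw [← (finsetEquivStrictMono n).hasSum_iff]
  convert! h using 2 with s
  conv_rhs => rw [← Finset.map_orderEmbOfFin_univ s.1 s.2]
  rw [Finset.prod_map]
  rfl

/-! ### Toeplitz determinant and enumeration of the zeros -/

/-- Solution of a unit lower triangular Toeplitz system by Cramer's rule. -/
lemma det_updateCol_toeplitz (m : ℕ) (e S : ℕ → ℝ)
    (hS : ∀ i, ∑ j ∈ Finset.range i, e (i - j) * S (j + 1) + S (i + 1) = -((i + 1) * e (i + 1))) :
    ((Matrix.of fun i j : Fin (m + 1) =>
      if j < i then e ((i : ℕ) - j) else if j = i then 1 else 0).updateCol (Fin.last m)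
        fun i => -(((i : ℕ) + 1 : ℝ) * e (i + 1))).det = S (m + 1) := by
  set T : Matrix (Fin (m + 1)) (Fin (m + 1)) ℝ := Matrix.of fun i j : Fin (m + 1) =>
      if j < i then e ((i : ℕ) - j) else if j = i then 1 else 0 with hT
  have hdet : T.det = 1 := by
    rw [Matrix.det_of_isLowerTriangular]
    · simp [hT]
    · intro i j hij
      have hij' : i < j := hij
      simp [hT, hij'.not_gt, hij'.ne']
  have hmul : T.mulVec (fun j => S (j + 1)) =
      fun i : Fin (m + 1) => -(((i : ℕ) + 1 : ℝ) * e (i + 1)) := by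
    funext i
    rw [← hS]
    simp only [Matrix.mulVec, dotProduct, hT, Matrix.of_apply]
    have h1 : ∀ j : Fin (m + 1), (if j < i then e ((i : ℕ) - j) else if j = i then 1 else 0) *
        S (j + 1) = (fun j : ℕ => (if j < (i : ℕ) then e (i - j) * S (j + 1) else 0) +
          if j = i then S (j + 1) else 0) j := fun j => by
      simp only [Fin.lt_def, Fin.ext_iff]
      split_ifs <;> first | omega | simp
    rw [Finset.sum_congr rfl fun j _ => h1 j, Fin.sum_univ_eq_sum_range
      (fun j : ℕ => (if j < (i : ℕ) then e (i - j) * S (j + 1) else 0) +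
          if j = i then S (j + 1) else 0), Finset.sum_add_distrib]
    congr 1
    · rw [← Finset.sum_filter]
      refine Finset.sum_congr ?_ fun _ _ => rfl
      ext j
      simp only [Finset.mem_filter, Finset.mem_range]
      omega
    · rw [Finset.sum_ite_eq' , if_pos (Finset.mem_range.2 i.2)]
  -- The right-hand column is T S with det T = 1, so Cramer's vector adj(T) T S is S; its last entry
  -- is the determinant.
  rw [← Matrix.cramer_apply, ← hmul, Matrix.cramer_eq_adjugate_mulVec, Matrix.mulVec_mulVec,
    Matrix.adjugate_mul, hdet, one_smul, Matrix.one_mulVec]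
  simp

/-- A locally finite infinite set of positive reals is enumerated by taking successive infima. -/
lemma strictMono_and_range_of_sInf {S : Set ℝ} (hfin : ∀ R, {x | x ∈ S ∧ x ≤ R}.Finite)
    (hinf : S.Infinite) (hpos : ∀ x ∈ S, 0 < x) {e : ℕ → ℝ} (h0 : e 0 = sInf S)
    (hsucc : ∀ k, e (k + 1) = sInf {x | e k < x ∧ x ∈ S}) :
    StrictMono e ∧ Set.range e = S := by
  have hleast : ∀ y, IsLeast {x | y < x ∧ x ∈ S} (sInf {x | y < x ∧ x ∈ S}) := by
    intro y
    obtain ⟨z, hzS, hyz⟩ : ∃ z ∈ S, y < z := by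
      by_contra! h
      exact hinf ((hfin y).subset fun x hx => ⟨hx, h x hx⟩)
    have hf : {x | (y < x ∧ x ∈ S) ∧ x ≤ z}.Finite := (hfin z).subset fun x hx => ⟨hx.1.2, hx.2⟩
    obtain ⟨x, ⟨hx, hxz⟩, hmin⟩ := Set.exists_min_image _ id hf ⟨z, ⟨hyz, hzS⟩, le_rfl⟩
    have : IsLeast {x | y < x ∧ x ∈ S} x := ⟨hx, fun t ht => by
      rcases le_total t z with h | h
      · exact hmin t ⟨ht, h⟩
      · exact hxz.trans h⟩
    rwa [this.csInf_eq]
  have h0' : e 0 = sInf {x | 0 < x ∧ x ∈ S} := by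
    rw [h0]
    congr 1
    ext x
    exact ⟨fun h => ⟨hpos x h, h⟩, fun h => h.2⟩
  have hmem : ∀ k, e k ∈ S := by
    intro k
    cases k with
    | zero => rw [h0']; exact (hleast 0).1.2
    | succ k => rw [hsucc]; exact (hleast _).1.2
  have hmono : StrictMono e := strictMono_nat_of_lt_succ fun k => by
    conv_rhs => rw [hsucc]
    exact (hleast _).1.1
  refine ⟨hmono, Set.Subset.antisymm (Set.range_subset_iff.2 hmem) fun x hx => ?_⟩
  by_contra hne
  have hlt : ∀ k, e k < x := by
    intro k
    refine lt_of_le_of_ne ?_ fun h => hne ⟨k, h⟩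
    induction k with
    | zero => rw [h0']; exact (hleast 0).2 ⟨hpos x hx, hx⟩
    | succ k ih =>
      rw [hsucc]
      exact (hleast _).2 ⟨lt_of_le_of_ne ih fun h => hne ⟨k, h⟩, hx⟩
  -- A missed x would bound every e k, putting infinitely many elements of S below x.
  exact Set.infinite_of_injective_forall_mem hmono.injective
    (fun k => (⟨hmem k, (hlt k).le⟩ : e k ∈ {y | y ∈ S ∧ y ≤ x})) (hfin x)

namespace PosSimpleZeros

lemma hasProd_mul {f : ℂ → ℂ} (hf : PosSimpleZeros f) (w : ℂ) :
    HasProd (fun x : {x : ℝ // f x = 0} => 1 - w * ((1 / (x : ℝ) : ℝ) : ℂ)) (f w) := by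
  convert! hf.hasProd w using 3 with x
  push_cast
  ring

/-- A power series without zero coefficients and of small order has infinitely many zeros. -/
lemma infinite_zeros {v : ℕ → ℝ} (hv : FastDecay v) (hf : PosSimpleZeros (powerSum v))
    (hne : ∀ n, v n ≠ 0) : {x : ℝ | powerSum v x = 0}.Infinite := by
  intro hfin
  have : Fintype {x : ℝ // powerSum v x = 0} := hfin.fintype
  -- With one more factor than there are zeros, the elementary symmetric sum is empty, yet it equals
  -- ± v n.
  set n := Fintype.card {x : ℝ // powerSum v x = 0} + 1
  have h := hasSum_esymm (fun x : {x : ℝ // powerSum v x = 0} => (one_div_pos.2 (hf.pos x.2)).le)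
    hf.summable_inv hv hf.hasProd_mul n
  have hempty : IsEmpty {s : Finset {x : ℝ // powerSum v x = 0} // s.card = n} :=
    ⟨fun s => by
      have := Finset.card_le_univ s.1
      rw [s.2] at this
      omega⟩
  have := h.unique hasSum_empty
  exact hne n (by simpa using this)

/-- Reindexing of the factorisation along an enumeration of the square roots of the zeros. -/
lemma hasProd_of_sq {f : ℂ → ℂ} (hf : PosSimpleZeros f) {l : ℕ → ℝ} (hl : Function.Injective l)
    (hrange : ∀ x, (∃ k, l k = x) ↔ 0 < x ∧ f ((x ^ 2 : ℝ) : ℂ) = 0) :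
    Summable (fun k => 1 / l k ^ 2) ∧
      ∀ w : ℂ, HasProd (fun k => 1 - w * ((1 / l k ^ 2 : ℝ) : ℂ)) (f w) := by
  have hmem : ∀ k, 0 < l k ∧ f ((l k ^ 2 : ℝ) : ℂ) = 0 := fun k => (hrange _).1 ⟨k, rfl⟩
  let φ : ℕ → {x : ℝ // f x = 0} := fun k => ⟨l k ^ 2, (hmem k).2⟩
  have hbij : Function.Bijective φ := by
    refine ⟨fun k k' h => hl ?_, fun x => ?_⟩
    · exact (pow_left_inj₀ (hmem k).1.le (hmem k').1.le two_ne_zero).1 (Subtype.ext_iff.1 h)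
    · have hx := hf.pos x.2
      obtain ⟨k, hk⟩ := (hrange √(x : ℝ)).2 ⟨Real.sqrt_pos.2 hx, by
        rw [Real.sq_sqrt hx.le]; exact x.2⟩
      refine ⟨k, Subtype.ext ?_⟩
      change l k ^ 2 = x
      rw [hk, Real.sq_sqrt hx.le]
  obtain ⟨e, he⟩ : ∃ e : ℕ ≃ {x : ℝ // f x = 0}, ∀ k, (e k : ℝ) = l k ^ 2 :=
    ⟨Equiv.ofBijective φ hbij, fun _ => rfl⟩
  refine ⟨?_, fun w => ?_⟩
  · simpa only [Function.comp_def, he] using e.summable_iff.2 hf.summable_inv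
  · simpa only [Function.comp_def, he] using e.hasProd_iff.2 (hf.hasProd_mul w)

end PosSimpleZeros

/-! ### Symmetric and power sums of the zeros of `N_ν` -/

section Zeros

variable {a b c ν : ℝ}

lemma besselNZero_spec (habc : (c = 0 ∧ a ≠ b) ∨ (0 < c ∧ a < b)) (hν : 0 ≤ ν)
    (hroot : ∀ x : ℝ, quadQ a b c x = 0 → x ≤ ν) (hQ : quadQ a b c ν ≠ 0) :
    StrictMono (besselNZero a b c ν) ∧
      Set.range (besselNZero a b c ν) = {x : ℝ | 0 < x ∧ besselN a b c ν (x : ℂ) = 0} := by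
  have hf := posSimpleZeros_quadCoeff habc hν hroot hQ
  have hv := fastDecay_quadCoeff hν hQ
  have hiff : ∀ x : ℝ, 0 < x → (besselN a b c ν x = 0 ↔
      powerSum (quadCoeff a b c ν) ((x ^ 2 : ℝ) : ℂ) = 0) := fun x => besselN_eq_zero_iff hν hQ
  have hinf := hf.infinite_zeros hv fun n h => by
    simpa [h] using quadCoeff_sign hν hroot hQ n
  refine strictMono_and_range_of_sInf (S := {x : ℝ | 0 < x ∧ besselN a b c ν (x : ℂ) = 0})
    (fun R => ?_) (fun hfin => hinf ?_) (fun x hx => hx.1) rfl fun k => ?_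
  · refine ((hf.finite_le (R ^ 2)).image Real.sqrt).subset ?_
    rintro x ⟨⟨hx, hNx⟩, hxR⟩
    exact ⟨x ^ 2, ⟨(hiff x hx).1 hNx, pow_le_pow_left₀ hx.le hxR 2⟩, Real.sqrt_sq hx.le⟩
  · refine (hfin.image fun x => x ^ 2).subset fun y hy => ?_
    have hy0 := hf.pos hy
    refine ⟨√y, ⟨Real.sqrt_pos.2 hy0, (hiff _ (Real.sqrt_pos.2 hy0)).2 ?_⟩, Real.sq_sqrt hy0.le⟩
    rw [Real.sq_sqrt hy0.le]
    exact hy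
  · rw [besselNZero]
    congr 1
    ext x
    -- The successor clause of `besselNZero` does not ask for positivity; it follows from the
    -- previous value being nonnegative.
    have hk : 0 ≤ besselNZero a b c ν k := by
      induction k with
      | zero => exact Real.sInf_nonneg fun x hx => hx.1.le
      | succ k ih => exact Real.sInf_nonneg fun x hx => ih.trans hx.1.le
    exact ⟨fun h => ⟨h.1, hk.trans_lt h.1, h.2⟩, fun h => ⟨h.1, h.2.2⟩⟩

lemma hasProd_besselNZero (habc : (c = 0 ∧ a ≠ b) ∨ (0 < c ∧ a < b)) (hν : 0 ≤ ν)
    (hroot : ∀ x : ℝ, quadQ a b c x = 0 → x ≤ ν) (hQ : quadQ a b c ν ≠ 0) :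
    Summable (fun k => 1 / besselNZero a b c ν k ^ 2) ∧ ∀ w : ℂ,
      HasProd (fun k => 1 - w * ((1 / besselNZero a b c ν k ^ 2 : ℝ) : ℂ))
        (powerSum (quadCoeff a b c ν) w) := by
  obtain ⟨hmono, hrange⟩ := besselNZero_spec habc hν hroot hQ
  refine (posSimpleZeros_quadCoeff habc hν hroot hQ).hasProd_of_sq hmono.injective fun x => ?_
  have h := Set.ext_iff.1 hrange x
  rw [Set.mem_range, Set.mem_ofPred_eq] at h
  rw [h]
  exact and_congr_right fun hx => besselN_eq_zero_iff hν hQ hx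

/-- The elementary symmetric sums of the reciprocal squares of the zeros. -/
noncomputable def zeroEsymm (a b c ν : ℝ) (n : ℕ) : ℝ :=
  quadQ a b c (ν + 2 * n) / (n.factorial * 4 ^ n * poch (ν + 1) n * quadQ a b c ν)

lemma zeroEsymm_eq (hν : 0 ≤ ν) (hQ : quadQ a b c ν ≠ 0) (n : ℕ) :
    (-1) ^ n * quadCoeff a b c ν n = zeroEsymm a b c ν n := by
  have hp := (poch_pos (x := ν + 1) (by linarith) n).ne'
  have hsq : (-1 : ℝ) ^ n * (-1) ^ n = 1 := by rw [← mul_pow]; simp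
  rw [quadCoeff, besselCoeff, zeroEsymm, mul_left_comm, ← mul_div_assoc ((-1) ^ n), hsq]
  field_simp

lemma hasSum_zeroEsymm (habc : (c = 0 ∧ a ≠ b) ∨ (0 < c ∧ a < b)) (hν : 0 ≤ ν)
    (hroot : ∀ x : ℝ, quadQ a b c x = 0 → x ≤ ν) (hQ : quadQ a b c ν ≠ 0) (n : ℕ) :
    HasSum (fun s : {s : Finset ℕ // s.card = n} => ∏ i ∈ s.1, 1 / besselNZero a b c ν i ^ 2)
      (zeroEsymm a b c ν n) := by
  obtain ⟨hs, hp⟩ := hasProd_besselNZero habc hν hroot hQ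
  rw [← zeroEsymm_eq hν hQ]
  exact hasSum_esymm (fun k => by positivity) hs (fastDecay_quadCoeff hν hQ) hp n

/-- The power sums of the reciprocal squares of the zeros. -/
noncomputable def zeroPowerSum (a b c ν : ℝ) (n : ℕ) : ℝ :=
  ∑' k, (1 / besselNZero a b c ν k ^ 2) ^ n

lemma hasSum_zeroPowerSum (habc : (c = 0 ∧ a ≠ b) ∨ (0 < c ∧ a < b)) (hν : 0 ≤ ν)
    (hroot : ∀ x : ℝ, quadQ a b c x = 0 → x ≤ ν) (hQ : quadQ a b c ν ≠ 0) (n : ℕ) :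
    HasSum (fun k => 1 / besselNZero a b c ν k ^ (2 * (n + 1)))
      (zeroPowerSum a b c ν (n + 1)) := by
  have h := (summable_pow_of_nonneg (fun k => by positivity)
    (hasProd_besselNZero habc hν hroot hQ).1 n).hasSum
  convert! h using 2 with k
  rw [div_pow, one_pow, ← pow_mul]

lemma newton_zeroPowerSum (habc : (c = 0 ∧ a ≠ b) ∨ (0 < c ∧ a < b)) (hν : 0 ≤ ν)
    (hroot : ∀ x : ℝ, quadQ a b c x = 0 → x ≤ ν) (hQ : quadQ a b c ν ≠ 0) (n : ℕ) :
    (n + 1) * zeroEsymm a b c ν (n + 1) = (-1) ^ n * ∑ k ∈ Finset.range (n + 1),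
      (-1) ^ k * zeroEsymm a b c ν k * zeroPowerSum a b c ν (n + 1 - k) := by
  have h := newton_hasSum (fun k => by positivity) (hasProd_besselNZero habc hν hroot hQ).1
    (hasSum_zeroEsymm habc hν hroot hQ) (n + 1)
  rw [Finset.sum_filter, Finset.Nat.sum_antidiagonal_eq_sum_range_succ
    (fun i j => if i < n + 1 then (-1) ^ i * zeroEsymm a b c ν i *
      ∑' k, (1 / besselNZero a b c ν k ^ 2) ^ j else 0), Finset.sum_range_succ,
    if_neg (lt_irrefl _), add_zero] at h
  push_cast at h
  rw [h, pow_succ, pow_succ, mul_assoc ((-1) ^ n), neg_one_mul, neg_neg, mul_one]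
  congr 1
  exact Finset.sum_congr rfl fun k hk => by
    rw [if_pos (Finset.mem_range.1 hk)]
    rfl

end Zeros

/-! ### The determinant formula and the first four sums -/

section Zeros

variable {a b c ν : ℝ}

/-- Newton's identity with the summation reversed. Scaling the k-th elementary sum by 4^k and the
k-th power sum by (-4)^k absorbs the signs and yields the system for `det_updateCol_toeplitz`. -/
lemma toeplitz_zeroPowerSum (habc : (c = 0 ∧ a ≠ b) ∨ (0 < c ∧ a < b)) (hν : 0 ≤ ν)
    (hroot : ∀ x : ℝ, quadQ a b c x = 0 → x ≤ ν) (hQ : quadQ a b c ν ≠ 0) (i : ℕ) :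
    ∑ j ∈ Finset.range i, (4 ^ (i - j) * zeroEsymm a b c ν (i - j)) *
        (4 ^ (j + 1) * (-1) ^ (j + 1) * zeroPowerSum a b c ν (j + 1)) +
      4 ^ (i + 1) * (-1) ^ (i + 1) * zeroPowerSum a b c ν (i + 1) =
        -((i + 1) * (4 ^ (i + 1) * zeroEsymm a b c ν (i + 1))) := by
  have h := newton_zeroPowerSum habc hν hroot hQ i
  have h0 : zeroEsymm a b c ν 0 = 1 := by simp [zeroEsymm, poch_zero, hQ]
  have hterm : ∀ j ∈ Finset.range (i + 1), (-1) ^ i * ((-1) ^ (i + 1 - 1 - j) *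
      zeroEsymm a b c ν (i + 1 - 1 - j) * zeroPowerSum a b c ν (i + 1 - (i + 1 - 1 - j))) =
      (-1) ^ j * (zeroEsymm a b c ν (i - j) * zeroPowerSum a b c ν (j + 1)) := fun j hj => by
    have hj' : j ≤ i := Nat.lt_succ_iff.1 (Finset.mem_range.1 hj)
    obtain ⟨k, rfl⟩ := Nat.exists_eq_add_of_le hj'
    have hsq : (-1 : ℝ) ^ k * (-1) ^ k = 1 := by rw [← mul_pow]; simp
    rw [show j + k + 1 - 1 - j = k by omega, show j + k + 1 - k = j + 1 by omega,
      show j + k - j = k by omega, pow_add]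
    linear_combination (-1) ^ j * zeroEsymm a b c ν k * zeroPowerSum a b c ν (j + 1) * hsq
  rw [← Finset.sum_range_reflect, Finset.mul_sum, Finset.sum_congr rfl hterm,
    Finset.sum_range_succ, Nat.sub_self, h0] at h
  have hl : ∑ j ∈ Finset.range i, (4 ^ (i - j) * zeroEsymm a b c ν (i - j)) *
        (4 ^ (j + 1) * (-1) ^ (j + 1) * zeroPowerSum a b c ν (j + 1)) =
      -4 ^ (i + 1) * ∑ j ∈ Finset.range i,
        (-1) ^ j * (zeroEsymm a b c ν (i - j) * zeroPowerSum a b c ν (j + 1)) := by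
    rw [Finset.mul_sum]
    refine Finset.sum_congr rfl fun j hj => ?_
    obtain ⟨k, rfl⟩ := Nat.exists_eq_add_of_lt (Finset.mem_range.1 hj)
    rw [show j + k + 1 - j = k + 1 by omega]
    ring
  rw [hl]
  linear_combination 4 ^ (i + 1) * h

lemma det_zeroSumMatrix (habc : (c = 0 ∧ a ≠ b) ∨ (0 < c ∧ a < b)) (hν : 0 ≤ ν)
    (hroot : ∀ x : ℝ, quadQ a b c x = 0 → x ≤ ν) (hQ : quadQ a b c ν ≠ 0) (m : ℕ) :
    (zeroSumMatrix a b c ν (m + 1)).det =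
      4 ^ (m + 1) * (-1) ^ (m + 1) * zeroPowerSum a b c ν (m + 1) := by
  rw [← det_updateCol_toeplitz m (fun k => 4 ^ k * zeroEsymm a b c ν k)
    (fun k => 4 ^ k * (-1) ^ k * zeroPowerSum a b c ν k) (toeplitz_zeroPowerSum habc hν hroot hQ)]
  have he : ∀ k : ℕ, 4 ^ k * zeroEsymm a b c ν k =
      quadQ a b c (ν + 2 * k) / (k.factorial * poch (ν + 1) k * quadQ a b c ν) := fun k => by
    have hp := (poch_pos (x := ν + 1) (by linarith) k).ne'
    rw [zeroEsymm]
    field_simp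
  congr 1
  ext i j
  simp only [he]
  rw [zeroSumMatrix, Matrix.of_apply, Matrix.updateCol_apply, Matrix.of_apply]
  by_cases hj : j = Fin.last m
  · have hp := (poch_pos (x := ν + 1) (by linarith) ((i : ℕ) + 1)).ne'
    -- The factor i + 1 from Newton's identity reduces (i+1)! to the i! of the last column.
    rw [if_pos hj, if_pos (by rw [hj, Fin.val_last]), Nat.factorial_succ]
    push_cast
    field_simp
  · rw [if_neg hj, if_neg fun h => hj (Fin.ext (by simpa using h))]


lemma poch_one (x : ℝ) : poch x 1 = x := by simp [poch_succ, poch_zero]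

lemma poch_two (x : ℝ) : poch x 2 = x * (x + 1) := by
  simp only [poch_succ, poch_zero]; push_cast; ring

lemma poch_three (x : ℝ) : poch x 3 = x * (x + 1) * (x + 2) := by
  simp only [poch_succ, poch_zero]; push_cast; ring

lemma poch_four (x : ℝ) : poch x 4 = x * (x + 1) * (x + 2) * (x + 3) := by
  simp only [poch_succ, poch_zero]; push_cast; ring

lemma prod_poch_two (x : ℝ) : ∏ j ∈ Finset.Icc 1 2, poch x j = x ^ 2 * (x + 1) := by
  rw [Finset.prod_Icc_succ_top (by norm_num), Finset.Icc_self, Finset.prod_singleton, poch_one,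
    poch_two]
  ring

lemma prod_poch_three (x : ℝ) :
    ∏ j ∈ Finset.Icc 1 3, poch x j = x ^ 3 * (x + 1) ^ 2 * (x + 2) := by
  rw [Finset.prod_Icc_succ_top (by norm_num), prod_poch_two, poch_three]
  ring

lemma prod_poch_four (x : ℝ) :
    ∏ j ∈ Finset.Icc 1 4, poch x j = x ^ 4 * (x + 1) ^ 3 * (x + 2) ^ 2 * (x + 3) := by
  rw [Finset.prod_Icc_succ_top (by norm_num), prod_poch_three, poch_four]
  ring

lemma zeroEsymm_zero (hQ : quadQ a b c ν ≠ 0) : zeroEsymm a b c ν 0 = 1 := by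
  simp [zeroEsymm, poch_zero, hQ]

lemma zeroEsymm_one : zeroEsymm a b c ν 1 =
    quadQ a b c (ν + 2) / (4 * (ν + 1) * quadQ a b c ν) := by
  rw [zeroEsymm, poch_one]; norm_num

lemma zeroEsymm_two : zeroEsymm a b c ν 2 =
    quadQ a b c (ν + 4) / (32 * ((ν + 1) * (ν + 2)) * quadQ a b c ν) := by
  rw [zeroEsymm, poch_two]; norm_num [Nat.factorial, add_assoc]

lemma zeroEsymm_three : zeroEsymm a b c ν 3 =
    quadQ a b c (ν + 6) / (384 * ((ν + 1) * (ν + 2) * (ν + 3)) * quadQ a b c ν) := by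
  rw [zeroEsymm, poch_three]; norm_num [Nat.factorial, add_assoc]

lemma zeroEsymm_four : zeroEsymm a b c ν 4 =
    quadQ a b c (ν + 8) / (6144 * ((ν + 1) * (ν + 2) * (ν + 3) * (ν + 4)) * quadQ a b c ν) := by
  rw [zeroEsymm, poch_four]; norm_num [Nat.factorial, add_assoc]

lemma zeroPowerSum_one (habc : (c = 0 ∧ a ≠ b) ∨ (0 < c ∧ a < b)) (hν : 0 ≤ ν)
    (hroot : ∀ x : ℝ, quadQ a b c x = 0 → x ≤ ν) (hQ : quadQ a b c ν ≠ 0) :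
    zeroPowerSum a b c ν 1 = (quadQ a b c (ν + 2) / (4 * poch (ν + 1) 1 * quadQ a b c ν)) := by
  have hrec : zeroPowerSum a b c ν 1 = zeroEsymm a b c ν 1 := by
    have := newton_zeroPowerSum habc hν hroot hQ 0
    norm_num [Finset.sum_range_succ, zeroEsymm_zero hQ] at this
    linear_combination -this
  rw [hrec, zeroEsymm_one, poch_one]

lemma zeroPowerSum_two (habc : (c = 0 ∧ a ≠ b) ∨ (0 < c ∧ a < b)) (hν : 0 ≤ ν)
    (hroot : ∀ x : ℝ, quadQ a b c x = 0 → x ≤ ν) (hQ : quadQ a b c ν ≠ 0) :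
    zeroPowerSum a b c ν 2 =
      (((ν + 2) * quadQ a b c (ν + 2) ^ 2 - (ν + 1) * quadQ a b c ν * quadQ a b c (ν + 4)) /
        (4 ^ 2 * quadQ a b c ν ^ 2 * ∏ j ∈ Finset.Icc 1 2, poch (ν + 1) j)) := by
  have h1 : ν + 1 ≠ 0 := by positivity
  have h2 : ν + 2 ≠ 0 := by positivity
  have hrec : zeroPowerSum a b c ν 2 = zeroEsymm a b c ν 1 * zeroPowerSum a b c ν 1
      - 2 * zeroEsymm a b c ν 2 := by
    have := newton_zeroPowerSum habc hν hroot hQ 1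
    norm_num [Finset.sum_range_succ, zeroEsymm_zero hQ] at this
    linear_combination this
  rw [hrec, zeroPowerSum_one habc hν hroot hQ, zeroEsymm_one, zeroEsymm_two]
  simp only [prod_poch_two, poch_one, add_assoc]
  norm_num [Nat.factorial]
  field_simp
  ring

lemma zeroPowerSum_three (habc : (c = 0 ∧ a ≠ b) ∨ (0 < c ∧ a < b)) (hν : 0 ≤ ν)
    (hroot : ∀ x : ℝ, quadQ a b c x = 0 → x ≤ ν) (hQ : quadQ a b c ν ≠ 0) :
    zeroPowerSum a b c ν 3 = ((poch (ν + 2) 2 * quadQ a b c (ν + 2) *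
            (2 * (ν + 2) * quadQ a b c (ν + 2) ^ 2
              - 3 * (ν + 1) * quadQ a b c ν * quadQ a b c (ν + 4))
          + (ν + 1) ^ 2 * (ν + 2) * quadQ a b c ν ^ 2 * quadQ a b c (ν + 6)) /
        ((Nat.factorial 2 : ℝ) * 4 ^ 3 * quadQ a b c ν ^ 3 *
          ∏ j ∈ Finset.Icc 1 3, poch (ν + 1) j)) := by
  have h1 : ν + 1 ≠ 0 := by positivity
  have h2 : ν + 2 ≠ 0 := by positivity
  have h3 : ν + 3 ≠ 0 := by positivity
  have hrec : zeroPowerSum a b c ν 3 = zeroEsymm a b c ν 1 * zeroPowerSum a b c ν 2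
      - zeroEsymm a b c ν 2 * zeroPowerSum a b c ν 1 + 3 * zeroEsymm a b c ν 3 := by
    have := newton_zeroPowerSum habc hν hroot hQ 2
    norm_num [Finset.sum_range_succ, zeroEsymm_zero hQ] at this
    linear_combination -this
  rw [hrec, zeroPowerSum_two habc hν hroot hQ, zeroPowerSum_one habc hν hroot hQ,
    zeroEsymm_one, zeroEsymm_two, zeroEsymm_three]
  simp only [prod_poch_two, prod_poch_three, poch_one, poch_two, add_assoc]
  norm_num [Nat.factorial]
  field_simp
  ring

lemma zeroPowerSum_four (habc : (c = 0 ∧ a ≠ b) ∨ (0 < c ∧ a < b)) (hν : 0 ≤ ν)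
    (hroot : ∀ x : ℝ, quadQ a b c x = 0 → x ≤ ν) (hQ : quadQ a b c ν ≠ 0) :
    zeroPowerSum a b c ν 4 = (poch (ν + 2) 2 *
          (6 * (ν + 2) * poch (ν + 2) 3 * quadQ a b c (ν + 2) ^ 4
            - 12 * poch (ν + 1) 4 * quadQ a b c ν * quadQ a b c (ν + 2) ^ 2 * quadQ a b c (ν + 4)
            + 4 * (ν + 1) * poch (ν + 1) 2 * (ν + 4) * quadQ a b c ν ^ 2 *
                quadQ a b c (ν + 2) * quadQ a b c (ν + 6)
            + (ν + 1) ^ 2 * quadQ a b c ν ^ 2 *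
                (3 * poch (ν + 3) 2 * quadQ a b c (ν + 4) ^ 2
                  - poch (ν + 1) 2 * quadQ a b c ν * quadQ a b c (ν + 8))) /
        ((Nat.factorial 3 : ℝ) * 4 ^ 4 * quadQ a b c ν ^ 4 *
          ∏ j ∈ Finset.Icc 1 4, poch (ν + 1) j)) := by
  have h1 : ν + 1 ≠ 0 := by positivity
  have h2 : ν + 2 ≠ 0 := by positivity
  have h3 : ν + 3 ≠ 0 := by positivity
  have h4 : ν + 4 ≠ 0 := by positivity
  have hrec : zeroPowerSum a b c ν 4 = zeroEsymm a b c ν 1 * zeroPowerSum a b c ν 3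
      - zeroEsymm a b c ν 2 * zeroPowerSum a b c ν 2
      + zeroEsymm a b c ν 3 * zeroPowerSum a b c ν 1 - 4 * zeroEsymm a b c ν 4 := by
    have := newton_zeroPowerSum habc hν hroot hQ 3
    norm_num [Finset.sum_range_succ, zeroEsymm_zero hQ] at this
    linear_combination this
  rw [hrec, zeroPowerSum_three habc hν hroot hQ, zeroPowerSum_two habc hν hroot hQ,
    zeroPowerSum_one habc hν hroot hQ, zeroEsymm_one, zeroEsymm_two, zeroEsymm_three,
    zeroEsymm_four]
  simp only [prod_poch_two, prod_poch_three, prod_poch_four, poch_one, poch_two, poch_three,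
    poch_four, add_assoc]
  norm_num [Nat.factorial]
  field_simp
  ring

end Zeros

end

theorem mainTheorem5 (a b c ν : ℝ)
    (habc : (c = 0 ∧ a ≠ b) ∨ (0 < c ∧ a < b))
    (hν : 0 ≤ ν) (hroot : ∀ x : ℝ, quadQ a b c x = 0 → x ≤ ν) (hQ : quadQ a b c ν ≠ 0) :
    -- `besselNZero a b c ν` is the increasing enumeration of all positive zeros
    (StrictMono (besselNZero a b c ν) ∧
      Set.range (besselNZero a b c ν) = {x : ℝ | 0 < x ∧ besselN a b c ν (x : ℂ) = 0}) ∧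
    -- elementary symmetric sums
    (∀ n : ℕ, 1 ≤ n →
      HasSum (fun k : {k : Fin n → ℕ // StrictMono k} =>
          ∏ i, 1 / besselNZero a b c ν (k.1 i) ^ 2)
        (Real.Gamma (ν + 1) * quadQ a b c (2 * n + ν) /
          ((n.factorial : ℝ) * 4 ^ n * Real.Gamma (n + ν + 1) * quadQ a b c ν)) ∧
      HasSum (fun k : {k : Fin n → ℕ // StrictMono k} =>
          ∏ i, 1 / besselNZero a b c ν (k.1 i) ^ 2)
        (quadQ a b c (2 * n + ν) /
          ((n.factorial : ℝ) * 4 ^ n * poch (ν + 1) n * quadQ a b c ν))) ∧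
    -- power sums as determinants
    (∀ n : ℕ, 1 ≤ n →
      HasSum (fun k : ℕ => 4 ^ n * (-1) ^ n / besselNZero a b c ν k ^ (2 * n))
        (zeroSumMatrix a b c ν n).det) ∧
    -- the first four power sums
    HasSum (fun k : ℕ => 1 / besselNZero a b c ν k ^ 2)
      (quadQ a b c (ν + 2) / (4 * poch (ν + 1) 1 * quadQ a b c ν)) ∧
    HasSum (fun k : ℕ => 1 / besselNZero a b c ν k ^ 4)
      (((ν + 2) * quadQ a b c (ν + 2) ^ 2 - (ν + 1) * quadQ a b c ν * quadQ a b c (ν + 4)) /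
        (4 ^ 2 * quadQ a b c ν ^ 2 * ∏ j ∈ Finset.Icc 1 2, poch (ν + 1) j)) ∧
    HasSum (fun k : ℕ => 1 / besselNZero a b c ν k ^ 6)
      ((poch (ν + 2) 2 * quadQ a b c (ν + 2) *
            (2 * (ν + 2) * quadQ a b c (ν + 2) ^ 2
              - 3 * (ν + 1) * quadQ a b c ν * quadQ a b c (ν + 4))
          + (ν + 1) ^ 2 * (ν + 2) * quadQ a b c ν ^ 2 * quadQ a b c (ν + 6)) /
        ((Nat.factorial 2 : ℝ) * 4 ^ 3 * quadQ a b c ν ^ 3 *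
          ∏ j ∈ Finset.Icc 1 3, poch (ν + 1) j)) ∧
    HasSum (fun k : ℕ => 1 / besselNZero a b c ν k ^ 8)
      (poch (ν + 2) 2 *
          (6 * (ν + 2) * poch (ν + 2) 3 * quadQ a b c (ν + 2) ^ 4
            - 12 * poch (ν + 1) 4 * quadQ a b c ν * quadQ a b c (ν + 2) ^ 2 * quadQ a b c (ν + 4)
            + 4 * (ν + 1) * poch (ν + 1) 2 * (ν + 4) * quadQ a b c ν ^ 2 *
                quadQ a b c (ν + 2) * quadQ a b c (ν + 6)
            + (ν + 1) ^ 2 * quadQ a b c ν ^ 2 *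
                (3 * poch (ν + 3) 2 * quadQ a b c (ν + 4) ^ 2
                  - poch (ν + 1) 2 * quadQ a b c ν * quadQ a b c (ν + 8))) /
        ((Nat.factorial 3 : ℝ) * 4 ^ 4 * quadQ a b c ν ^ 4 *
          ∏ j ∈ Finset.Icc 1 4, poch (ν + 1) j)) := by
  have hps := hasSum_zeroPowerSum habc hν hroot hQ
  have hesymm : ∀ n : ℕ, HasSum (fun k : {k : Fin n → ℕ // StrictMono k} =>
      ∏ i, 1 / besselNZero a b c ν (k.1 i) ^ 2) (zeroEsymm a b c ν n) := fun n =>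
    hasSum_strictMono (x := fun k => 1 / besselNZero a b c ν k ^ 2)
      (hasSum_zeroEsymm habc hν hroot hQ n)
  refine ⟨besselNZero_spec habc hν hroot hQ, fun n _ => ?_, fun n hn => ?_, ?_, ?_, ?_, ?_⟩
  · have h1 := (poch_pos (x := ν + 1) (by linarith) n).ne'
    have h2 := (Real.Gamma_pos_of_pos (by linarith : 0 < ν + 1)).ne'
    have e2 : zeroEsymm a b c ν n = quadQ a b c (2 * n + ν) /
        ((n.factorial : ℝ) * 4 ^ n * poch (ν + 1) n * quadQ a b c ν) := by
      rw [zeroEsymm, add_comm (2 * (n : ℝ))]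
    have e1 : zeroEsymm a b c ν n = Real.Gamma (ν + 1) * quadQ a b c (2 * n + ν) /
        ((n.factorial : ℝ) * 4 ^ n * Real.Gamma (n + ν + 1) * quadQ a b c ν) := by
      rw [e2, Gamma_add_natCast hν]
      field_simp
    exact ⟨e1 ▸ hesymm n, e2 ▸ hesymm n⟩
  · obtain ⟨m, rfl⟩ := Nat.exists_eq_add_of_le' hn
    rw [det_zeroSumMatrix habc hν hroot hQ]
    have h := (hps m).mul_left (4 ^ (m + 1) * (-1) ^ (m + 1))
    simp only [mul_one_div] at h
    exact h
  · rw [← zeroPowerSum_one habc hν hroot hQ]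
    simpa only [zero_add, mul_one, Nat.reduceAdd, Nat.reduceMul] using hps 0
  · rw [← zeroPowerSum_two habc hν hroot hQ]
    simpa only [zero_add, mul_one, Nat.reduceAdd, Nat.reduceMul] using hps 1
  · rw [← zeroPowerSum_three habc hν hroot hQ]
    simpa only [zero_add, mul_one, Nat.reduceAdd, Nat.reduceMul] using hps 2
  · rw [← zeroPowerSum_four habc hν hroot hQ]
    simpa only [zero_add, mul_one, Nat.reduceAdd, Nat.reduceMul] using hps 3
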